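/- **Setting.** Let $M^n$ be a smooth $n$-dimensional manifold, $D\subset TM^n\setminus 0$ an open conic set (closed under $y\mapsto cy$, $c>0$), and $F^n=(M^n,L)$ a Finsler space on $D$: $L:D\to(0,\infty)$ is smooth, positively homogeneous of degree $1$ in $y$, and $g_{ij}=\tfrac12\dot\partial_i\dot\partial_jL^2$ is positive definite ($\partial_i=\partial/\partial x^i$, $\dot\partial_i=\partial/\partial y^i$). Put $l_i=\dot\partial_iL$, $h_{ij}=g_{ij}-l_il_j$, $C_{ijk}=\tfrac12\dot\partial_ig_{jk}$, $C^r_{ij}=g^{rs}C_{sij}$, and let $(F^i_{jk},G^i_j,C^i_{jk})$ be the Cartan connection: $G^i_j=\dot\partial_j\big(\tfrac12\gamma^i_{kl}y^ky^l\big)$ with $\gamma^i_{kl}$ the formal Christoffel symbols of $g_{ij}$, and $F^i_{jk}=\tfrac12g^{ir}(\delta_jg_{rk}+\delta_kg_{rj}-\delta_rg_{jk})$ with $\delta_j=\partial_j-G^r_j\dot\partial_r$. Its h- and v-covariant derivatives are denoted by ${}_{|j}$ and $|_j$; for a covector field, $X_{i|j}=\delta_jX_i-X_rF^r_{ij}$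 and $X_i|_j=\dot\partial_jX_i-X_rC^r_{ij}$. The index $0$ denotes contraction with $y$. An *h-vector* is a smooth covector field $b_i(x,y)$ on $D$ with $b_i|_k=0$ and $L\,C^h_{ij}b_h=\rho\,h_{ij}$ for a scalar function $\rho$ on $D$ without zeros. It is a *gradient* if $b_{i|j}=b_{j|i}$. The *h-exponential change* is ${}^*L=L\,e^{\beta/L}$ with $\beta=b_i(x,y)y^i$; it is assumed that ${}^*F^n=(M^n,{}^*L)$ is again a Finsler space on $D$. $F^n$ is a *$*P$-Finsler space* if $P^r_{ij}:=C^r_{ij|0}=\lambda\,C^r_{ij}$ for some scalar function $\lambda$ on $D$. Let $M^{n-1}\to M^n$, $x^i=x^i(u^\alpha)$, be a smooth immersed hypersurface, with projection factors $B^i_\alpha=\partial x^i/\partial u^\alpha$ and $B^i_{\alpha\beta}=\partial^2x^i/\partial u^\alpha\partial u^\beta$. At each supporting element $(u,v)$ with $(x(u),y)\in D$, $y^i=B^i_\alpha v^\alpha$, let $N^i$ be the unit normal, determined up to sign by $g_{ij}B^i_\alpha N^j=0$, $g_{ij}N^iN^j=1$; put $N_i=g_{ij}N^j$ and $$M_\alpha=C_{ijk}B^i_\alpha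 N^jN^k,\qquad M_{\alpha\beta}=C_{ijk}B^i_\alpha B^j_\beta N^k,\qquad H_\alpha=N_i\big(B^i_{\beta\alpha}v^\beta+G^i_jB^j_\alpha\big),$$ $$H_{\alpha\beta}=N_i\big(B^i_{\alpha\beta}+F^i_{jk}B^j_\alpha B^k_\beta\big)+M_\alpha H_\beta .$$ The hypersurface $F^{n-1}$ of $F^n$ is a *hyperplane of the second kind* if $H_{\alpha\beta}=0$, and *of the third kind* if $H_{\alpha\beta}=0=M_{\alpha\beta}$, at all such $(u,v)$. For the same hypersurface regarded in ${}^*F^n$, denoted ${}^*F^{n-1}$, these notions are defined by the same formulas with $L$ replaced by ${}^*L$. The vector $b_i$ is *tangential* to $F^{n-1}$ if $b_jN^j=0$ at all such $(u,v)$. **Theorem 5.1.** Let $F^n$ be a $*P$-Finsler space, and let the h-vector $b_i$ be a gradient and tangential to the hypersurface $F^{n-1}$ of $F^n$. Then: 1. if $F^{n-1}$ is a hyperplane of the second kind and $M_{\alpha\beta}=0$, then ${}^*F^{n-1}$ is a hyperplane of the second kind; 2. if $F^{n-1}$ is a hyperplane of the third kind, then ${}^*F^{n-1}$ is a hyperplane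 of the third kind. -/

import Mathlib

open scoped Manifold ContDiff

noncomputable section

namespace FinslerHyp

/-- Coordinate space. -/
abbrev Vec (n : ℕ) : Type := EuclideanSpace ℝ (Fin n)

/-- The `i`-th coordinate vector. -/
abbrev coordVec {n : ℕ} (i : Fin n) : Vec n := EuclideanSpace.single i (1 : ℝ)

/-! ## Finsler geometry in local coordinates

Functions of the coordinates `(x, y)` of the tangent bundle; `ℓ` is the coordinate expression of the
fundamental function. -/

/-- `∂_i F = ∂F/∂x^i`. -/
def pdx {n : ℕ} (i : Fin n) (F : Vec n × Vec n → ℝ) (p : Vec n × Vec n) : ℝ :=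
  fderiv ℝ F p (coordVec i, 0)

/-- `∂̇_i F = ∂F/∂y^i`. -/
def pdy {n : ℕ} (i : Fin n) (F : Vec n × Vec n → ℝ) (p : Vec n × Vec n) : ℝ :=
  fderiv ℝ F p (0, coordVec i)

/-- Metric tensor `g_ij = ½ ∂̇_i ∂̇_j L²`. -/
def metric {n : ℕ} (ℓ : Vec n × Vec n → ℝ) (i j : Fin n) (p : Vec n × Vec n) : ℝ :=
  (1 / 2) * pdy i (pdy j (fun q => ℓ q ^ 2)) p

/-- The matrix `(g_ij)`. -/
def metricMatrix {n : ℕ} (ℓ : Vec n × Vec n → ℝ) (p : Vec n × Vec n) :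
    Matrix (Fin n) (Fin n) ℝ :=
  Matrix.of fun i j => metric ℓ i j p

/-- `g^ij`, the inverse of the metric tensor. -/
def invMetric {n : ℕ} (ℓ : Vec n × Vec n → ℝ) (i j : Fin n) (p : Vec n × Vec n) : ℝ :=
  (metricMatrix ℓ p)⁻¹ i j

/-- Angular metric tensor `h_ij = g_ij - l_i l_j`, where `l_i = ∂̇_i L`. -/
def angular {n : ℕ} (ℓ : Vec n × Vec n → ℝ) (i j : Fin n) (p : Vec n × Vec n) : ℝ :=
  metric ℓ i j p - pdy i ℓ p * pdy j ℓ p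

/-- Cartan tensor `C_ijk = ½ ∂̇_i g_jk`. -/
def cartan {n : ℕ} (ℓ : Vec n × Vec n → ℝ) (i j k : Fin n) (p : Vec n × Vec n) : ℝ :=
  (1 / 2) * pdy i (metric ℓ j k) p

/-- `C^r_ij = g^rs C_sij`. -/
def cartanUp {n : ℕ} (ℓ : Vec n × Vec n → ℝ) (r i j : Fin n) (p : Vec n × Vec n) : ℝ :=
  ∑ s, invMetric ℓ r s p * cartan ℓ s i j p

/-- Formal Christoffel symbols `γ^i_jk = ½ g^ir (∂_j g_rk + ∂_k g_rj - ∂_r g_jk)`. -/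
def christoffel {n : ℕ} (ℓ : Vec n × Vec n → ℝ) (i j k : Fin n) (p : Vec n × Vec n) : ℝ :=
  (1 / 2) * ∑ r, invMetric ℓ i r p *
    (pdx j (metric ℓ r k) p + pdx k (metric ℓ r j) p - pdx r (metric ℓ j k) p)

/-- Geodesic spray coefficients `G^i = ½ γ^i_jk y^j y^k`. -/
def spray {n : ℕ} (ℓ : Vec n × Vec n → ℝ) (i : Fin n) (p : Vec n × Vec n) : ℝ :=
  (1 / 2) * ∑ j, ∑ k, christoffel ℓ i j k p * p.2 j * p.2 k

/-- Cartan's nonlinear connection `N^i_j = G^i_j = ∂̇_j G^i`. -/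
def nonlin {n : ℕ} (ℓ : Vec n × Vec n → ℝ) (i j : Fin n) (p : Vec n × Vec n) : ℝ :=
  pdy j (spray ℓ i) p

/-- `δ_j F = ∂_j F - N^r_j ∂̇_r F`. -/
def hderiv {n : ℕ} (ℓ : Vec n × Vec n → ℝ) (j : Fin n) (F : Vec n × Vec n → ℝ)
    (p : Vec n × Vec n) : ℝ :=
  pdx j F p - ∑ r, nonlin ℓ r j p * pdy r F p

/-- Coefficients `F^i_jk = ½ g^ir (δ_j g_rk + δ_k g_rj - δ_r g_jk)` of the Cartan connection. -/
def cartanConn {n : ℕ} (ℓ : Vec n × Vec n → ℝ) (i j k : Fin n) (p : Vec n × Vec n) : ℝ :=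
  (1 / 2) * ∑ r, invMetric ℓ i r p *
    (hderiv ℓ j (metric ℓ r k) p + hderiv ℓ k (metric ℓ r j) p - hderiv ℓ r (metric ℓ j k) p)

/-- h-covariant derivative `X_{i|j} = ∂_j X_i - N^r_j ∂̇_r X_i - X_r F^r_ij` of a covector field. -/
def hcov {n : ℕ} (ℓ : Vec n × Vec n → ℝ) (X : Fin n → Vec n × Vec n → ℝ) (i j : Fin n)
    (p : Vec n × Vec n) : ℝ :=
  hderiv ℓ j (X i) p - ∑ r, X r p * cartanConn ℓ r i j p

/-- v-covariant derivative `X_i|_j = ∂̇_j X_i - X_r C^r_ij` of a covector field. -/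
def vcov {n : ℕ} (ℓ : Vec n × Vec n → ℝ) (X : Fin n → Vec n × Vec n → ℝ) (i j : Fin n)
    (p : Vec n × Vec n) : ℝ :=
  pdy j (X i) p - ∑ r, X r p * cartanUp ℓ r i j p

/-- h-covariant derivative `C^r_{ij|k}` of the tensor `C^r_ij`. -/
def hcovCartan {n : ℕ} (ℓ : Vec n × Vec n → ℝ) (r i j k : Fin n) (p : Vec n × Vec n) : ℝ :=
  hderiv ℓ k (cartanUp ℓ r i j) p + (∑ s, cartanUp ℓ s i j p * cartanConn ℓ r s k p)
    - (∑ s, cartanUp ℓ r s j p * cartanConn ℓ s i k p)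
    - ∑ s, cartanUp ℓ r i s p * cartanConn ℓ s j k p

/-- The `(v)hv`-torsion tensor `P^r_ij = C^r_{ij|0} = C^r_{ij|k} y^k`. -/
def torsionP {n : ℕ} (ℓ : Vec n × Vec n → ℝ) (r i j : Fin n) (p : Vec n × Vec n) : ℝ :=
  ∑ k, hcovCartan ℓ r i j k p * p.2 k

/-! ## Hypersurfaces in local coordinates

`x : Vec n → Vec (n + 1)` is a parametrization `x^i = x^i(u^α)`, and `v` is the supporting element
of the hypersurface at `u`. -/

/-- The supporting element `(x(u), y)`, `y^i = B^i_α v^α`, of the ambient space. -/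
def support {n m : ℕ} (x : Vec n → Vec m) (u v : Vec n) : Vec m × Vec m :=
  (x u, fderiv ℝ x u v)

/-- Projection factors `B^i_α = ∂x^i/∂u^α`. -/
def projFactor {n m : ℕ} (x : Vec n → Vec m) (i : Fin m) (α : Fin n) (u : Vec n) : ℝ :=
  fderiv ℝ (fun w => x w i) u (coordVec α)

/-- `B^i_αβ = ∂²x^i/∂u^α∂u^β`. -/
def projFactor₂ {n m : ℕ} (x : Vec n → Vec m) (i : Fin m) (α β : Fin n) (u : Vec n) : ℝ :=
  fderiv ℝ (projFactor x i β) u (coordVec α)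

/-- `N` is a unit normal vector at `(u, v)`: `g_ij B^i_α N^j = 0` and `g_ij N^i N^j = 1`.
It is determined up to its sign. -/
def IsUnitNormal {n m : ℕ} (ℓ : Vec m × Vec m → ℝ) (x : Vec n → Vec m) (u v : Vec n)
    (N : Vec m) : Prop :=
  (∀ α : Fin n, ∑ i, ∑ j, metric ℓ i j (support x u v) * projFactor x i α u * N j = 0) ∧
    ∑ i, ∑ j, metric ℓ i j (support x u v) * N i * N j = 1

/-- `N_i = g_ij N^j`. -/
def conormal {n m : ℕ} (ℓ : Vec m × Vec m → ℝ) (x : Vec n → Vec m) (u v : Vec n)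
    (N : Vec m) (i : Fin m) : ℝ :=
  ∑ j, metric ℓ i j (support x u v) * N j

/-- `M_α = C_ijk B^i_α N^j N^k`. -/
def vecM {n m : ℕ} (ℓ : Vec m × Vec m → ℝ) (x : Vec n → Vec m) (u v : Vec n)
    (N : Vec m) (α : Fin n) : ℝ :=
  ∑ i, ∑ j, ∑ k, cartan ℓ i j k (support x u v) * projFactor x i α u * N j * N k

/-- Second fundamental v-tensor `M_αβ = C_ijk B^i_α B^j_β N^k`. -/
def secondFundV {n m : ℕ} (ℓ : Vec m × Vec m → ℝ) (x : Vec n → Vec m) (u v : Vec n)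
    (N : Vec m) (α β : Fin n) : ℝ :=
  ∑ i, ∑ j, ∑ k,
    cartan ℓ i j k (support x u v) * projFactor x i α u * projFactor x j β u * N k

/-- Normal curvature vector `H_α = N_i (B^i_0α + G^i_j B^j_α)`, `B^i_0α = B^i_βα v^β`. -/
def normalCurv {n m : ℕ} (ℓ : Vec m × Vec m → ℝ) (x : Vec n → Vec m) (u v : Vec n)
    (N : Vec m) (α : Fin n) : ℝ :=
  ∑ i, conormal ℓ x u v N i *
    ((∑ β, projFactor₂ x i β α u * v β) +
      ∑ j, nonlin ℓ i j (support x u v) * projFactor x j α u)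

/-- Second fundamental h-tensor `H_αβ = N_i (B^i_αβ + F^i_jk B^j_α B^k_β) + M_α H_β`. -/
def secondFundH {n m : ℕ} (ℓ : Vec m × Vec m → ℝ) (x : Vec n → Vec m) (u v : Vec n)
    (N : Vec m) (α β : Fin n) : ℝ :=
  (∑ i, conormal ℓ x u v N i *
    (projFactor₂ x i α β u +
      ∑ j, ∑ k, cartanConn ℓ i j k (support x u v) * projFactor x j α u * projFactor x k β u))
    + vecM ℓ x u v N α * normalCurv ℓ x u v N β

/-! ## Finsler spaces on manifolds

A fundamental function is defined on an open conic set `D` of nonzero tangent vectors. All tensorial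
conditions are imposed on the components in every chart of the smooth structure. -/

/-- The tangent vector of `M` with coordinates `(x, y)` in the chart `φ`. -/
def chartVec {m : ℕ} {M : Type*} [TopologicalSpace M] [ChartedSpace (Vec m) M]
    (φ : OpenPartialHomeomorph M (Vec m)) (p : Vec m × Vec m) : TangentBundle (𝓡 m) M :=
  ⟨φ.symm p.1, mfderiv (𝓡 m) (𝓡 m) φ.symm p.1 p.2⟩

/-- The set of the coordinates `(x, y)` of the elements of `D` over the domain of the chart `φ`. -/
def chartDomain {m : ℕ} {M : Type*} [TopologicalSpace M] [ChartedSpace (Vec m) M]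
    (φ : OpenPartialHomeomorph M (Vec m)) (D : Set (TangentBundle (𝓡 m) M)) :
    Set (Vec m × Vec m) :=
  {p | p.1 ∈ φ.target ∧ chartVec φ p ∈ D}

/-- Coordinate expression `L(x, y)` of a function on the tangent bundle. -/
def chartFun {m : ℕ} {M : Type*} [TopologicalSpace M] [ChartedSpace (Vec m) M]
    (φ : OpenPartialHomeomorph M (Vec m)) (L : TangentBundle (𝓡 m) M → ℝ)
    (p : Vec m × Vec m) : ℝ :=
  L (chartVec φ p)

/-- Components `b_i(x, y)` of a covector field `b` that depends on the supporting element. -/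
def chartCovec {m : ℕ} {M : Type*} [TopologicalSpace M] [ChartedSpace (Vec m) M]
    (φ : OpenPartialHomeomorph M (Vec m))
    (b : ∀ w : TangentBundle (𝓡 m) M, TangentSpace (𝓡 m) w.1 →L[ℝ] ℝ)
    (i : Fin m) (p : Vec m × Vec m) : ℝ :=
  b (chartVec φ p) (mfderiv (𝓡 m) (𝓡 m) φ.symm p.1 (coordVec i))

/-- `(M, L)` is a Finsler space, with `L` defined on the open conic set `D` of nonzero tangent
vectors (`D` may be the whole slit tangent bundle). -/
structure IsFinsler {m : ℕ} {M : Type*} [TopologicalSpace M] [ChartedSpace (Vec m) M]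
    [IsManifold (𝓡 m) ∞ M] (D : Set (TangentBundle (𝓡 m) M))
    (L : TangentBundle (𝓡 m) M → ℝ) : Prop where
  isOpen : IsOpen D
  ne_zero : ∀ w ∈ D, w.2 ≠ 0
  conic : ∀ w ∈ D, ∀ c : ℝ, 0 < c → (⟨w.1, c • w.2⟩ : TangentBundle (𝓡 m) M) ∈ D
  smooth : ContMDiffOn (𝓡 m).tangent 𝓘(ℝ, ℝ) ∞ L D
  pos : ∀ w ∈ D, 0 < L w
  homogeneous : ∀ w ∈ D, ∀ c : ℝ, 0 < c →
    L (⟨w.1, c • w.2⟩ : TangentBundle (𝓡 m) M) = c * L w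
  posDef : ∀ φ ∈ IsManifold.maximalAtlas (𝓡 m) ∞ M, ∀ p ∈ chartDomain φ D,
    (metricMatrix (chartFun φ L) p).PosDef

/-- `b` is an h-vector: a smooth covector field `b_i(x, y)` on `D` with `b_i|_k = 0` and
`L C^h_ij b_h = ρ h_ij` for a non-zero scalar function `ρ`. -/
def IsHVector {m : ℕ} {M : Type*} [TopologicalSpace M] [ChartedSpace (Vec m) M]
    [IsManifold (𝓡 m) ∞ M] (D : Set (TangentBundle (𝓡 m) M))
    (L : TangentBundle (𝓡 m) M → ℝ)
    (b : ∀ w : TangentBundle (𝓡 m) M, TangentSpace (𝓡 m) w.1 →L[ℝ] ℝ) : Prop :=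
  (∀ φ ∈ IsManifold.maximalAtlas (𝓡 m) ∞ M, ∀ i,
    ContDiffOn ℝ ∞ (chartCovec φ b i) (chartDomain φ D)) ∧
  (∀ φ ∈ IsManifold.maximalAtlas (𝓡 m) ∞ M, ∀ p ∈ chartDomain φ D, ∀ i k,
    vcov (chartFun φ L) (chartCovec φ b) i k p = 0) ∧
  ∃ ρ : TangentBundle (𝓡 m) M → ℝ, (∀ w ∈ D, ρ w ≠ 0) ∧
    ∀ φ ∈ IsManifold.maximalAtlas (𝓡 m) ∞ M, ∀ p ∈ chartDomain φ D, ∀ i j,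
      chartFun φ L p * ∑ h, cartanUp (chartFun φ L) h i j p * chartCovec φ b h p =
        ρ (chartVec φ p) * angular (chartFun φ L) i j p

/-- `b` is a gradient: `b_{i|j} = b_{j|i}`. -/
def IsGradient {m : ℕ} {M : Type*} [TopologicalSpace M] [ChartedSpace (Vec m) M]
    [IsManifold (𝓡 m) ∞ M] (D : Set (TangentBundle (𝓡 m) M))
    (L : TangentBundle (𝓡 m) M → ℝ)
    (b : ∀ w : TangentBundle (𝓡 m) M, TangentSpace (𝓡 m) w.1 →L[ℝ] ℝ) : Prop :=
  ∀ φ ∈ IsManifold.maximalAtlas (𝓡 m) ∞ M, ∀ p ∈ chartDomain φ D, ∀ i j,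
    hcov (chartFun φ L) (chartCovec φ b) i j p = hcov (chartFun φ L) (chartCovec φ b) j i p

/-- `(M, L)` is a `*P`-Finsler space: `P^r_ij = lam C^r_ij` for a scalar function `lam`. -/
def IsStarP {m : ℕ} {M : Type*} [TopologicalSpace M] [ChartedSpace (Vec m) M]
    [IsManifold (𝓡 m) ∞ M] (D : Set (TangentBundle (𝓡 m) M))
    (L : TangentBundle (𝓡 m) M → ℝ) : Prop :=
  ∃ lam : TangentBundle (𝓡 m) M → ℝ,
    ∀ φ ∈ IsManifold.maximalAtlas (𝓡 m) ∞ M, ∀ p ∈ chartDomain φ D, ∀ r i j,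
      torsionP (chartFun φ L) r i j p = lam (chartVec φ p) * cartanUp (chartFun φ L) r i j p

/-- The h-exponential change `*L = L e^{β/L}`, `β = b_i(x, y) y^i`. -/
def expChange {m : ℕ} {M : Type*} [TopologicalSpace M] [ChartedSpace (Vec m) M]
    (L : TangentBundle (𝓡 m) M → ℝ)
    (b : ∀ w : TangentBundle (𝓡 m) M, TangentSpace (𝓡 m) w.1 →L[ℝ] ℝ)
    (w : TangentBundle (𝓡 m) M) : ℝ :=
  L w * Real.exp (b w w.2 / L w)

/-- `f : S → M` is an immersed smooth hypersurface. -/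
structure IsHypersurface {n : ℕ} {M S : Type*} [TopologicalSpace M]
    [ChartedSpace (Vec (n + 1)) M] [TopologicalSpace S] [ChartedSpace (Vec n) S]
    (f : S → M) : Prop where
  smooth : ContMDiff (𝓡 n) (𝓡 (n + 1)) ∞ f
  immersion : ∀ s, Function.Injective (mfderiv (𝓡 n) (𝓡 (n + 1)) f s)

/-- Coordinate expression `x^i = x^i(u^α)` of the hypersurface. -/
def chartParam {n m : ℕ} {M S : Type*} [TopologicalSpace M] [TopologicalSpace S]
    (φ : OpenPartialHomeomorph M (Vec m)) (ψ : OpenPartialHomeomorph S (Vec n))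
    (f : S → M) (u : Vec n) : Vec m :=
  φ (f (ψ.symm u))

/-- The coordinates `(u, v)` of the supporting elements of the hypersurface: `u` lies in the domain
of `x^i = x^i(u^α)`, and `L` is defined at the tangent vector `y^i = B^i_α v^α`. -/
def chartSupport {n m : ℕ} {M S : Type*} [TopologicalSpace M] [ChartedSpace (Vec m) M]
    [TopologicalSpace S] (φ : OpenPartialHomeomorph M (Vec m))
    (ψ : OpenPartialHomeomorph S (Vec n)) (f : S → M) (D : Set (TangentBundle (𝓡 m) M)) :
    Set (Vec n × Vec n) :=
  {q | q.1 ∈ ψ.target ∧ f (ψ.symm q.1) ∈ φ.source ∧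
    support (chartParam φ ψ f) q.1 q.2 ∈ chartDomain φ D}

/-- `b` is tangential to the hypersurface: `b_j N^j = 0`. -/
def IsTangential {n : ℕ} {M S : Type*} [TopologicalSpace M] [ChartedSpace (Vec (n + 1)) M]
    [IsManifold (𝓡 (n + 1)) ∞ M] [TopologicalSpace S] [ChartedSpace (Vec n) S]
    [IsManifold (𝓡 n) ∞ S] (D : Set (TangentBundle (𝓡 (n + 1)) M))
    (L : TangentBundle (𝓡 (n + 1)) M → ℝ)
    (b : ∀ w : TangentBundle (𝓡 (n + 1)) M, TangentSpace (𝓡 (n + 1)) w.1 →L[ℝ] ℝ)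
    (f : S → M) : Prop :=
  ∀ φ ∈ IsManifold.maximalAtlas (𝓡 (n + 1)) ∞ M, ∀ ψ ∈ IsManifold.maximalAtlas (𝓡 n) ∞ S,
    ∀ q ∈ chartSupport φ ψ f D, ∀ N : Vec (n + 1),
      IsUnitNormal (chartFun φ L) (chartParam φ ψ f) q.1 q.2 N →
        ∑ j, chartCovec φ b j (support (chartParam φ ψ f) q.1 q.2) * N j = 0

/-- `M_αβ = 0` on the hypersurface. -/
def VTensorVanishes {n : ℕ} {M S : Type*} [TopologicalSpace M] [ChartedSpace (Vec (n + 1)) M]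
    [IsManifold (𝓡 (n + 1)) ∞ M] [TopologicalSpace S] [ChartedSpace (Vec n) S]
    [IsManifold (𝓡 n) ∞ S] (D : Set (TangentBundle (𝓡 (n + 1)) M))
    (L : TangentBundle (𝓡 (n + 1)) M → ℝ) (f : S → M) : Prop :=
  ∀ φ ∈ IsManifold.maximalAtlas (𝓡 (n + 1)) ∞ M, ∀ ψ ∈ IsManifold.maximalAtlas (𝓡 n) ∞ S,
    ∀ q ∈ chartSupport φ ψ f D, ∀ N : Vec (n + 1),
      IsUnitNormal (chartFun φ L) (chartParam φ ψ f) q.1 q.2 N →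
        ∀ α β, secondFundV (chartFun φ L) (chartParam φ ψ f) q.1 q.2 N α β = 0

/-- The hypersurface is a hyperplane of the second kind: `H_αβ = 0`. -/
def IsHyperplaneSecondKind {n : ℕ} {M S : Type*} [TopologicalSpace M]
    [ChartedSpace (Vec (n + 1)) M] [IsManifold (𝓡 (n + 1)) ∞ M] [TopologicalSpace S]
    [ChartedSpace (Vec n) S] [IsManifold (𝓡 n) ∞ S]
    (D : Set (TangentBundle (𝓡 (n + 1)) M)) (L : TangentBundle (𝓡 (n + 1)) M → ℝ)
    (f : S → M) : Prop :=
  ∀ φ ∈ IsManifold.maximalAtlas (𝓡 (n + 1)) ∞ M, ∀ ψ ∈ IsManifold.maximalAtlas (𝓡 n) ∞ S,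
    ∀ q ∈ chartSupport φ ψ f D, ∀ N : Vec (n + 1),
      IsUnitNormal (chartFun φ L) (chartParam φ ψ f) q.1 q.2 N →
        ∀ α β, secondFundH (chartFun φ L) (chartParam φ ψ f) q.1 q.2 N α β = 0

/-- The hypersurface is a hyperplane of the third kind: `H_αβ = 0 = M_αβ`. -/
def IsHyperplaneThirdKind {n : ℕ} {M S : Type*} [TopologicalSpace M]
    [ChartedSpace (Vec (n + 1)) M] [IsManifold (𝓡 (n + 1)) ∞ M] [TopologicalSpace S]
    [ChartedSpace (Vec n) S] [IsManifold (𝓡 n) ∞ S]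
    (D : Set (TangentBundle (𝓡 (n + 1)) M)) (L : TangentBundle (𝓡 (n + 1)) M → ℝ)
    (f : S → M) : Prop :=
  IsHyperplaneSecondKind D L f ∧ VTensorVanishes D L f

end FinslerHyp

end

/-!
The theorem holds at the level of geodesics. All computations take place in a chart, with the
energy `E = ½ L²`, whose vertical second and third derivatives are `g` and `2 C`, and with the
geodesic field `S = (y, -2G)`, which is characterized by the Euler–Lagrange equation
`S (∂̇_i E) = ∂_i E` (`IsLocalFinsler.spray_eq`).

* Contracting `H_αβ = 0` with `v^α v^β` gives `N_i (B^i_αβ v^α v^β + 2 G^i) = 0`: the hypersurface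
  contains the geodesics that are tangent to it (`isGeodesicLocal_of_secondFundH`).
* Conversely, if this holds and `M_αβ = 0`, then `H_αβ = 0`. Up to a factor the conormal `N_i`
  depends on the point of the hypersurface only, so the identity can be differentiated twice in
  `v`; this gives `H_α = 0` and the vanishing of `H_αβ` with the Berwald coefficients `∂̇_k G^i_j`
  in place of the Cartan coefficients. The two differ by `P_ijk = C_{ijk|0}`
  (`IsLocalFinsler.cartan_berwald`), and `P (N, B_α, B_β) = 0` follows from differentiating
  `C (N, B_α, B_β) = 0` along geodesics of the hypersurface (`IsGeodesicLocal.secondFund_eq_zero`).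
* For an h-vector, `∂̇_i β = b_i` and `∂̇_j b_i` is proportional to the angular metric, and for a
  gradient one `S (∂̇_i β) = ∂_i β` (`IsLocalHVector.geod_hform`). Since `b` is tangential, both
  `dL` and `dβ` vanish on the vertical lift of the normal `N`, so that in the second derivatives of
  `½ L² exp (2 β / L)` involving `N` only multiples of those of `L` and `β` remain. Therefore `N`
  is also normal for the changed metric (`IsLocalHVector.metric_expChange`), and the difference of
  the two sprays is tangent to the hypersurface (`IsLocalHVector.spray_expChange`). Thus the
  hypersurface also contains the geodesics of the changed space that are tangent to it.
* `M_αβ = 0` says that the normal direction does not depend on the supporting element. As the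
  normal directions are the same for both metrics, this condition passes to the changed space
  (`VTensorVanishesLocal.transfer`).

These facts together show that `H_αβ` and `M_αβ` vanish for the changed space
(`secondFund_expChange`).
-/

noncomputable section

namespace FinslerHyp

/-! ### Higher derivatives of smooth functions on open sets -/

section Calculus

variable {E F : Type*} [NormedAddCommGroup E] [NormedSpace ℝ E] [NormedAddCommGroup F]
  [NormedSpace ℝ F] {U : Set E} {f : E → F} {p : E}

/-- The second derivative of `f`, as an iterated Fréchet derivative. -/
abbrev d2 (f : E → F) : E → E →L[ℝ] E →L[ℝ] F := fderiv ℝ (fderiv ℝ f)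

/-- The third derivative of `f`; the first argument is the direction differentiated last. -/
abbrev d3 (f : E → F) : E → E →L[ℝ] E →L[ℝ] E →L[ℝ] F := fderiv ℝ (d2 f)

/-- The fourth derivative of `f`; the first argument is the direction differentiated last. -/
abbrev d4 (f : E → F) : E → E →L[ℝ] E →L[ℝ] E →L[ℝ] E →L[ℝ] F := fderiv ℝ (d3 f)

lemma smoothOn_fderiv (hU : IsOpen U) (hf : ContDiffOn ℝ ∞ f U) :
    ContDiffOn ℝ ∞ (fderiv ℝ f) U :=
  hf.fderiv_of_isOpen hU (by simp)

lemma differentiableAt_of_smoothOn (hU : IsOpen U) (hf : ContDiffOn ℝ ∞ f U) (hp : p ∈ U) :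
    DifferentiableAt ℝ f p :=
  (hf.differentiableOn (by simp)).differentiableAt (hU.mem_nhds hp)

lemma d2_symm (hU : IsOpen U) (hf : ContDiffOn ℝ ∞ f U) (hp : p ∈ U) (a b : E) :
    d2 f p a b = d2 f p b a :=
  ((hf.contDiffAt (hU.mem_nhds hp)).isSymmSndFDerivAt (by simpa using ENat.LEInfty.out)) a b

lemma d3_symm₁₂ (hU : IsOpen U) (hf : ContDiffOn ℝ ∞ f U) (hp : p ∈ U) (a b c : E) :
    d3 f p a b c = d3 f p b a c :=
  congrArg (· c) (d2_symm hU (smoothOn_fderiv hU hf) hp a b)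

/-- Functions that agree on an open set have the same derivatives there. -/
lemma fderiv_eq_of_eqOn {f g : E → F} (hU : IsOpen U) (h : ∀ q ∈ U, f q = g q) (hp : p ∈ U) :
    fderiv ℝ f p = fderiv ℝ g p :=
  Filter.EventuallyEq.fderiv_eq (Filter.eventually_of_mem (hU.mem_nhds hp) h)

lemma fderiv_clm_apply_const {G : Type*} [NormedAddCommGroup G] [NormedSpace ℝ G]
    {A : E → F →L[ℝ] G} (hA : DifferentiableAt ℝ A p) (b : F) (a : E) :
    fderiv ℝ (fun q => A q b) p a = fderiv ℝ A p a b := by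
  rw [fderiv_clm_apply hA (differentiableAt_const b)]
  simp

lemma d3_symm₂₃ (hU : IsOpen U) (hf : ContDiffOn ℝ ∞ f U) (hp : p ∈ U) (a b c : E) :
    d3 f p a b c = d3 f p a c b := by
  have h2 := smoothOn_fderiv hU (smoothOn_fderiv hU hf)
  have key : ∀ b c : E, d3 f p a b c = fderiv ℝ (fun q => d2 f q b c) p a := by
    intro b c
    have hd := differentiableAt_of_smoothOn hU h2 hp
    rw [fderiv_clm_apply_const (A := fun q => d2 f q b) (hd.clm_apply (differentiableAt_const b)),
      fderiv_clm_apply_const hd]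
  rw [key, key, fderiv_eq_of_eqOn hU (fun q hq => d2_symm hU hf hq b c) hp]

lemma d4_symm₁₂ (hU : IsOpen U) (hf : ContDiffOn ℝ ∞ f U) (hp : p ∈ U) (a b c d : E) :
    d4 f p a b c d = d4 f p b a c d :=
  congrArg (· d) (d3_symm₁₂ hU (smoothOn_fderiv hU hf) hp a b c)

lemma d4_symm₂₃ (hU : IsOpen U) (hf : ContDiffOn ℝ ∞ f U) (hp : p ∈ U) (a b c d : E) :
    d4 f p a b c d = d4 f p a c b d :=
  congrArg (· d) (d3_symm₂₃ hU (smoothOn_fderiv hU hf) hp a b c)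

lemma d4_symm₃₄ (hU : IsOpen U) (hf : ContDiffOn ℝ ∞ f U) (hp : p ∈ U) (a b c d : E) :
    d4 f p a b c d = d4 f p a b d c := by
  have h3 := smoothOn_fderiv hU (smoothOn_fderiv hU (smoothOn_fderiv hU hf))
  have key : ∀ c d : E, d4 f p a b c d = fderiv ℝ (fun q => d3 f q b c d) p a := by
    intro c d
    have hd := differentiableAt_of_smoothOn hU h3 hp
    have hd1 := hd.clm_apply (differentiableAt_const b)
    rw [fderiv_clm_apply_const (A := fun q => d3 f q b c)
      (hd1.clm_apply (differentiableAt_const c)),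
      fderiv_clm_apply_const (A := fun q => d3 f q b) hd1, fderiv_clm_apply_const hd]
  rw [key, key, fderiv_eq_of_eqOn hU (fun q hq => d3_symm₂₃ hU hf hq b c d) hp]

variable {γ a b c : ℝ → E} {γ' a' b' c' : E} {t : ℝ}

lemma hasDerivAt_d0 (hU : IsOpen U) (hf : ContDiffOn ℝ ∞ f U) (hγ : HasDerivAt γ γ' t)
    (hp : γ t ∈ U) : HasDerivAt (fun s => f (γ s)) (fderiv ℝ f (γ t) γ') t :=
  (differentiableAt_of_smoothOn hU hf hp).hasFDerivAt.comp_hasDerivAt t hγ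

/-- Leibniz rule for `Df` along a curve, evaluated on a vector field along the curve. -/
lemma hasDerivAt_d1 (hU : IsOpen U) (hf : ContDiffOn ℝ ∞ f U) (hγ : HasDerivAt γ γ' t)
    (hp : γ t ∈ U) (ha : HasDerivAt a a' t) :
    HasDerivAt (fun s => fderiv ℝ f (γ s) (a s))
      (d2 f (γ t) γ' (a t) + fderiv ℝ f (γ t) a') t :=
  (hasDerivAt_d0 hU (smoothOn_fderiv hU hf) hγ hp).clm_apply ha

/-- Leibniz rule for `D²f` along a curve, evaluated on vector fields along the curve. -/
lemma hasDerivAt_d2 (hU : IsOpen U) (hf : ContDiffOn ℝ ∞ f U) (hγ : HasDerivAt γ γ' t)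
    (hp : γ t ∈ U) (ha : HasDerivAt a a' t) (hb : HasDerivAt b b' t) :
    HasDerivAt (fun s => d2 f (γ s) (a s) (b s))
      (d3 f (γ t) γ' (a t) (b t) + d2 f (γ t) a' (b t) + d2 f (γ t) (a t) b') t := by
  simpa using (hasDerivAt_d1 hU (smoothOn_fderiv hU hf) hγ hp ha).clm_apply hb

/-- Leibniz rule for `D³f` along a curve, evaluated on vector fields along the curve. -/
lemma hasDerivAt_d3 (hU : IsOpen U) (hf : ContDiffOn ℝ ∞ f U) (hγ : HasDerivAt γ γ' t)
    (hp : γ t ∈ U) (ha : HasDerivAt a a' t) (hb : HasDerivAt b b' t) (hc : HasDerivAt c c' t) :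
    HasDerivAt (fun s => d3 f (γ s) (a s) (b s) (c s))
      (d4 f (γ t) γ' (a t) (b t) (c t) + d3 f (γ t) a' (b t) (c t) + d3 f (γ t) (a t) b' (c t)
        + d3 f (γ t) (a t) (b t) c') t := by
  simpa using (hasDerivAt_d2 hU (smoothOn_fderiv hU hf) hγ hp ha hb).clm_apply hc

lemma hasDerivAt_line (p w : E) : HasDerivAt (fun t : ℝ => p + t • w) w 0 := by
  simpa using ((hasDerivAt_id (0 : ℝ)).smul_const w).const_add p

/-- Two functions of `t` that agree as long as a differentiable curve stays in an open set have the
same derivative at `t = 0`. -/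
lemma deriv_unique_of_eqOn {G : Type*} [NormedAddCommGroup G] [NormedSpace ℝ G]
    (hU : IsOpen U) (hγ : HasDerivAt γ γ' 0) (hp : γ 0 ∈ U)
    {φ ψ : ℝ → G} {φ' ψ' : G} (h : ∀ t, γ t ∈ U → φ t = ψ t)
    (hφ : HasDerivAt φ φ' 0) (hψ : HasDerivAt ψ ψ' 0) : φ' = ψ' := by
  refine hφ.unique (hψ.congr_of_eventuallyEq ?_)
  exact (hγ.continuousAt.eventually (hU.mem_nhds hp)).mono h

end Calculus

/-! ### Finsler functions in a chart -/

/-- A Finsler function on an open conic set `U` of coordinates `(x, y)`. -/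
structure IsLocalFinsler {m : ℕ} (U : Set (Vec m × Vec m)) (ℓ : Vec m × Vec m → ℝ) : Prop where
  isOpen : IsOpen U
  conic : ∀ p ∈ U, ∀ c : ℝ, 0 < c → (p.1, c • p.2) ∈ U
  smooth : ContDiffOn ℝ ∞ ℓ U
  pos : ∀ p ∈ U, 0 < ℓ p
  homogeneous : ∀ p ∈ U, ∀ c : ℝ, 0 < c → ℓ (p.1, c • p.2) = c * ℓ p
  posDef : ∀ p ∈ U, (metricMatrix ℓ p).PosDef

/-- The energy `½ ℓ²`; its vertical second and third derivatives are `g` and `2 C`. -/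
def energy {m : ℕ} (ℓ : Vec m × Vec m → ℝ) (p : Vec m × Vec m) : ℝ := (1 / 2) * ℓ p ^ 2

section LocalFinsler

variable {m : ℕ} {U : Set (Vec m × Vec m)} {ℓ : Vec m × Vec m → ℝ} {p : Vec m × Vec m}

lemma IsLocalFinsler.energy_smooth (h : IsLocalFinsler U ℓ) : ContDiffOn ℝ ∞ (energy ℓ) U :=
  contDiffOn_const.mul (h.smooth.pow 2)

/-- Euler's relation `y^i ∂̇_i L = L`. -/
lemma IsLocalFinsler.euler (h : IsLocalFinsler U ℓ) (hp : p ∈ U) :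
    fderiv ℝ ℓ p (0, p.2) = ℓ p := by
  have h1 : HasDerivAt (fun t : ℝ => ℓ (p + t • (0, p.2))) (fderiv ℝ ℓ p (0, p.2)) 0 := by
    simpa using hasDerivAt_d0 h.isOpen h.smooth (hasDerivAt_line p (0, p.2)) (by simpa using hp)
  have h2 : HasDerivAt (fun t : ℝ => (1 + t) * ℓ p) (ℓ p) 0 := by
    simpa using ((hasDerivAt_id (0 : ℝ)).const_add 1).mul_const (ℓ p)
  refine h1.unique (h2.congr_of_eventuallyEq ?_)
  filter_upwards [lt_mem_nhds (show (-1 : ℝ) < 0 by norm_num)] with t ht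
  have e : p + t • ((0 : Vec m), p.2) = (p.1, (1 + t) • p.2) := by
    ext <;> simp [add_mul]
  rw [e, h.homogeneous p hp _ (by linarith)]

lemma fderiv_energy (hU : IsOpen U) (hs : ContDiffOn ℝ ∞ ℓ U) (hp : p ∈ U) (w : Vec m × Vec m) :
    fderiv ℝ (energy ℓ) p w = ℓ p * fderiv ℝ ℓ p w := by
  have h1 := hasDerivAt_d0 hU hs (hasDerivAt_line p w) (by simpa using hp)
  have hE : ContDiffOn ℝ ∞ (energy ℓ) U := contDiffOn_const.mul (hs.pow 2)
  have h2 := hasDerivAt_d0 hU hE (hasDerivAt_line p w) (by simpa using hp)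
  have h3 := (h1.pow 2).const_mul (1 / 2)
  have h4 := h2.unique h3
  simp only [zero_smul, add_zero] at h4
  rw [h4]; norm_num; ring

lemma IsLocalFinsler.euler_energy (h : IsLocalFinsler U ℓ) (hp : p ∈ U) :
    fderiv ℝ (energy ℓ) p (0, p.2) = 2 * energy ℓ p := by
  rw [fderiv_energy h.isOpen h.smooth hp, h.euler hp, energy]; ring

/-- First derivative of Euler's relation for the energy. -/
lemma IsLocalFinsler.d2_euler (h : IsLocalFinsler U ℓ) (hp : p ∈ U) (w : Vec m × Vec m) :
    d2 (energy ℓ) p w (0, p.2) =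
      2 * fderiv ℝ (energy ℓ) p w - fderiv ℝ (energy ℓ) p (0, w.2) := by
  have hγ := hasDerivAt_line p w
  have hγ2 : HasDerivAt (fun t : ℝ => ((0 : Vec m), (p + t • w).2)) (0, w.2) 0 :=
    (hasDerivAt_const _ _).prodMk (by simpa using hasDerivAt_line p.2 w.2)
  have key := deriv_unique_of_eqOn h.isOpen hγ (by simpa using hp)
    (fun t ht => h.euler_energy ht)
    (hasDerivAt_d1 h.isOpen h.energy_smooth hγ (by simpa using hp) hγ2)
    ((hasDerivAt_d0 h.isOpen h.energy_smooth hγ (by simpa using hp)).const_mul 2)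
  simp only [zero_smul, add_zero] at key
  linarith

/-- Second derivative of Euler's relation for the energy. -/
lemma IsLocalFinsler.d3_euler (h : IsLocalFinsler U ℓ) (hp : p ∈ U) (w z : Vec m × Vec m) :
    d3 (energy ℓ) p w z (0, p.2) =
      2 * d2 (energy ℓ) p w z - d2 (energy ℓ) p w (0, z.2) - d2 (energy ℓ) p z (0, w.2) := by
  have hγ := hasDerivAt_line p w
  have hp' : p + (0 : ℝ) • w ∈ U := by simpa using hp
  have hγ2 : HasDerivAt (fun t : ℝ => ((0 : Vec m), (p + t • w).2)) (0, w.2) 0 :=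
    (hasDerivAt_const _ _).prodMk (by simpa using hasDerivAt_line p.2 w.2)
  have key := deriv_unique_of_eqOn h.isOpen hγ hp'
    (fun t ht => h.d2_euler ht z)
    (hasDerivAt_d2 h.isOpen h.energy_smooth hγ hp' (hasDerivAt_const _ z) hγ2)
    (((hasDerivAt_d1 h.isOpen h.energy_smooth hγ hp' (hasDerivAt_const _ z)).const_mul 2).sub
      (hasDerivAt_d1 h.isOpen h.energy_smooth hγ hp' (hasDerivAt_const _ _)))
  simp only [zero_smul, add_zero, map_zero, zero_apply] at key
  linarith

/-- `g_ij y^j = ∂̇_i (½ L²)`. -/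
lemma IsLocalFinsler.metric_radial (h : IsLocalFinsler U ℓ) (hp : p ∈ U) (ξ : Vec m) :
    d2 (energy ℓ) p (0, ξ) (0, p.2) = fderiv ℝ (energy ℓ) p (0, ξ) := by
  rw [h.d2_euler hp]; ring

/-- `C_ijk y^k = 0`. -/
lemma IsLocalFinsler.cartan_radial (h : IsLocalFinsler U ℓ) (hp : p ∈ U) (ξ η : Vec m) :
    d3 (energy ℓ) p (0, ξ) (0, η) (0, p.2) = 0 := by
  rw [h.d3_euler hp, d2_symm h.isOpen h.energy_smooth hp (0, η)]; ring

/-! ### Components and contractions -/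

lemma sum_coord (A : Vec m →ₗ[ℝ] ℝ) (ξ : Vec m) : ∑ i, A (coordVec i) * ξ i = A ξ := by
  conv_rhs => rw [← (EuclideanSpace.basisFun (Fin m) ℝ).sum_repr ξ]
  simp [mul_comm]

lemma metric_eq (h : IsLocalFinsler U ℓ) (hp : p ∈ U) (i j : Fin m) :
    metric ℓ i j p = d2 (energy ℓ) p (0, coordVec i) (0, coordVec j) := by
  have hs : ContDiffOn ℝ ∞ (fun q => ℓ q ^ 2) U := h.smooth.pow 2
  have h1 : ∀ q ∈ U, fderiv ℝ (energy ℓ) q (0, coordVec j)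
      = (1 / 2) * pdy j (fun q => ℓ q ^ 2) q := by
    intro q hq
    unfold energy pdy
    rw [fderiv_const_mul (differentiableAt_of_smoothOn h.isOpen hs hq)]
    simp
  rw [← fderiv_clm_apply_const (differentiableAt_of_smoothOn h.isOpen
    (smoothOn_fderiv h.isOpen h.energy_smooth) hp), fderiv_eq_of_eqOn h.isOpen h1 hp,
    fderiv_const_mul]
  · simp [metric, pdy]
  · exact (differentiableAt_of_smoothOn h.isOpen (smoothOn_fderiv h.isOpen hs) hp).clm_apply
      (differentiableAt_const _)

lemma fderiv_metric (h : IsLocalFinsler U ℓ) (hp : p ∈ U) (i j : Fin m) (w : Vec m × Vec m) :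
    fderiv ℝ (metric ℓ i j) p w = d3 (energy ℓ) p w (0, coordVec i) (0, coordVec j) := by
  have hd := differentiableAt_of_smoothOn h.isOpen
    (smoothOn_fderiv h.isOpen (smoothOn_fderiv h.isOpen h.energy_smooth)) hp
  rw [fderiv_eq_of_eqOn h.isOpen (fun q hq => metric_eq h hq i j) hp,
    fderiv_clm_apply_const (A := fun q => d2 (energy ℓ) q (0, coordVec i))
      (hd.clm_apply (differentiableAt_const _)), fderiv_clm_apply_const hd]

lemma cartan_eq (h : IsLocalFinsler U ℓ) (hp : p ∈ U) (i j k : Fin m) :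
    cartan ℓ i j k p =
      (1 / 2) * d3 (energy ℓ) p (0, coordVec i) (0, coordVec j) (0, coordVec k) := by
  rw [cartan, pdy, fderiv_metric h hp]

/-- A linear functional on vectors, contracted in the vertical slot. -/
lemma sum_vert (A : Vec m × Vec m →L[ℝ] ℝ) (ξ : Vec m) :
    ∑ i, A (0, coordVec i) * ξ i = A (0, ξ) :=
  sum_coord (A.toLinearMap ∘ₗ LinearMap.inr ℝ (Vec m) (Vec m)) ξ

lemma sum_metric_left (h : IsLocalFinsler U ℓ) (hp : p ∈ U) (ξ : Vec m) (j : Fin m) :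
    ∑ i, metric ℓ i j p * ξ i = d2 (energy ℓ) p (0, ξ) (0, coordVec j) := by
  rw [d2_symm h.isOpen h.energy_smooth hp, ← sum_vert]
  exact Finset.sum_congr rfl fun i _ => by
    rw [metric_eq h hp, d2_symm h.isOpen h.energy_smooth hp]

lemma sum_metric_right (h : IsLocalFinsler U ℓ) (hp : p ∈ U) (ξ : Vec m) (i : Fin m) :
    ∑ j, metric ℓ i j p * ξ j = d2 (energy ℓ) p (0, coordVec i) (0, ξ) := by
  rw [← sum_vert]
  exact Finset.sum_congr rfl fun i _ => by rw [metric_eq h hp]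

lemma sum_metric (h : IsLocalFinsler U ℓ) (hp : p ∈ U) (ξ η : Vec m) :
    ∑ i, ∑ j, metric ℓ i j p * ξ i * η j = d2 (energy ℓ) p (0, ξ) (0, η) := by
  rw [Finset.sum_comm]
  simp_rw [← Finset.sum_mul, sum_metric_left h hp]
  exact sum_vert _ η

lemma metric_symm (h : IsLocalFinsler U ℓ) (hp : p ∈ U) (i j : Fin m) :
    metric ℓ i j p = metric ℓ j i p := by
  rw [metric_eq h hp, metric_eq h hp, d2_symm h.isOpen h.energy_smooth hp]

lemma sum_cartan (h : IsLocalFinsler U ℓ) (hp : p ∈ U) (ξ η ζ : Vec m) :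
    ∑ i, ∑ j, ∑ k, cartan ℓ i j k p * ξ i * η j * ζ k =
      (1 / 2) * d3 (energy ℓ) p (0, ξ) (0, η) (0, ζ) := by
  have e1 : ∀ i j, ∑ k, cartan ℓ i j k p * ξ i * η j * ζ k =
      (1 / 2) * (d3 (energy ℓ) p (0, ζ) (0, coordVec i) (0, coordVec j) * η j) * ξ i := by
    intro i j
    rw [d3_symm₁₂ h.isOpen h.energy_smooth hp, d3_symm₂₃ h.isOpen h.energy_smooth hp, ← sum_vert]
    simp_rw [Finset.sum_mul, Finset.mul_sum, Finset.sum_mul]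
    refine Finset.sum_congr rfl fun k _ => ?_
    rw [cartan_eq h hp]; ring
  have e2 : ∀ i, ∑ j, ∑ k, cartan ℓ i j k p * ξ i * η j * ζ k =
      (1 / 2) * (d3 (energy ℓ) p (0, ζ) (0, η) (0, coordVec i) * ξ i) := by
    intro i
    simp_rw [e1, ← Finset.sum_mul, ← Finset.mul_sum, sum_vert]
    rw [d3_symm₂₃ h.isOpen h.energy_smooth hp]; ring
  simp_rw [e2, ← Finset.mul_sum, sum_vert]
  rw [d3_symm₂₃ h.isOpen h.energy_smooth hp, d3_symm₁₂ h.isOpen h.energy_smooth hp,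
    d3_symm₂₃ h.isOpen h.energy_smooth hp]

lemma metric_pos (h : IsLocalFinsler U ℓ) (hp : p ∈ U) {ξ : Vec m} (hξ : ξ ≠ 0) :
    0 < d2 (energy ℓ) p (0, ξ) (0, ξ) := by
  rw [← sum_metric h hp]
  have := (h.posDef p hp).dotProduct_mulVec_pos (x := fun i => ξ i)
    (fun h0 => hξ (by ext i; exact congrFun h0 i))
  simp only [dotProduct, Matrix.mulVec, metricMatrix, Matrix.of_apply, Finset.mul_sum] at this
  refine this.trans_eq (Finset.sum_congr rfl fun i _ => Finset.sum_congr rfl fun j _ => ?_)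
  simp only [star_trivial]; ring

lemma sum_metric_invMetric (h : IsLocalFinsler U ℓ) (hp : p ∈ U) (i k : Fin m) :
    ∑ j, metric ℓ i j p * invMetric ℓ j k p = if i = k then 1 else 0 := by
  have hdet : IsUnit (metricMatrix ℓ p).det := (h.posDef p hp).det_pos.ne'.isUnit
  have := congrFun (congrFun (Matrix.mul_nonsing_inv _ hdet) i) k
  simpa [Matrix.mul_apply, Matrix.one_apply, metricMatrix, invMetric] using this

end LocalFinsler

/-! ### The spray and the Cartan connection -/

section Spray

variable {m : ℕ} {U : Set (Vec m × Vec m)} {ℓ : Vec m × Vec m → ℝ} {p : Vec m × Vec m}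

lemma contDiffOn_det {E : Type*} [NormedAddCommGroup E] [NormedSpace ℝ E] {s : Set E} {k : ℕ}
    {A : E → Matrix (Fin k) (Fin k) ℝ} (hA : ∀ i j, ContDiffOn ℝ ∞ (fun q => A q i j) s) :
    ContDiffOn ℝ ∞ (fun q => (A q).det) s := by
  simp_rw [Matrix.det_apply']
  exact ContDiffOn.sum fun σ _ => contDiffOn_const.mul (contDiffOn_prod fun i _ => hA _ _)

lemma contDiffOn_matrix_inv {E : Type*} [NormedAddCommGroup E] [NormedSpace ℝ E] {s : Set E}
    {k : ℕ} {A : E → Matrix (Fin k) (Fin k) ℝ}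
    (hA : ∀ i j, ContDiffOn ℝ ∞ (fun q => A q i j) s) (h0 : ∀ q ∈ s, (A q).det ≠ 0) (i j : Fin k) :
    ContDiffOn ℝ ∞ (fun q => (A q)⁻¹ i j) s := by
  simp_rw [Matrix.inv_def, Matrix.smul_apply, Ring.inverse_eq_inv', Matrix.adjugate_apply]
  refine ((contDiffOn_det hA).inv h0).mul (contDiffOn_det fun a b => ?_)
  by_cases h : a = j
  · subst h; simpa using contDiffOn_const
  · simpa [Matrix.updateRow_ne h] using hA a b

lemma metric_smooth (h : IsLocalFinsler U ℓ) (i j : Fin m) : ContDiffOn ℝ ∞ (metric ℓ i j) U := by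
  have h2 := smoothOn_fderiv h.isOpen (smoothOn_fderiv h.isOpen h.energy_smooth)
  exact ((h2.clm_apply contDiffOn_const).clm_apply contDiffOn_const).congr
    fun q hq => metric_eq h hq i j

lemma invMetric_smooth (h : IsLocalFinsler U ℓ) (i j : Fin m) :
    ContDiffOn ℝ ∞ (invMetric ℓ i j) U :=
  contDiffOn_matrix_inv (fun i j => metric_smooth h i j)
    (fun q hq => (h.posDef q hq).det_pos.ne') i j

/-- The vector `G^i` of spray coefficients. -/
def sprayVec (ℓ : Vec m × Vec m → ℝ) (p : Vec m × Vec m) : Vec m :=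
  WithLp.toLp 2 fun i => spray ℓ i p

lemma spray_smooth (h : IsLocalFinsler U ℓ) (i : Fin m) : ContDiffOn ℝ ∞ (spray ℓ i) U := by
  have hx : ∀ i j k : Fin m, ContDiffOn ℝ ∞ (pdx i (metric ℓ j k)) U := fun i j k =>
    (smoothOn_fderiv h.isOpen (metric_smooth h j k)).clm_apply contDiffOn_const
  have hy : ∀ j : Fin m, ContDiffOn ℝ ∞ (fun p : Vec m × Vec m => p.2 j) U := fun j =>
    ((EuclideanSpace.proj (𝕜 := ℝ) j).contDiff.comp contDiff_snd).contDiffOn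
  refine contDiffOn_const.mul (ContDiffOn.sum fun j _ => ContDiffOn.sum fun k _ =>
    ((contDiffOn_const.mul (ContDiffOn.sum fun r _ => ?_)).mul (hy j)).mul (hy k))
  exact (invMetric_smooth h i r).mul (((hx _ _ _).add (hx _ _ _)).sub (hx _ _ _))

lemma sprayVec_smooth (h : IsLocalFinsler U ℓ) : ContDiffOn ℝ ∞ (sprayVec ℓ) U :=
  contDiffOn_euclidean.2 fun i => spray_smooth h i

lemma nonlin_eq (h : IsLocalFinsler U ℓ) (hp : p ∈ U) (i j : Fin m) :
    nonlin ℓ i j p = fderiv ℝ (sprayVec ℓ) p (0, coordVec j) i := by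
  have := (EuclideanSpace.proj (𝕜 := ℝ) i).hasFDerivAt.comp p
    (differentiableAt_of_smoothOn h.isOpen (sprayVec_smooth h) hp).hasFDerivAt
  rw [nonlin, pdy, show spray ℓ i = (EuclideanSpace.proj (𝕜 := ℝ) i) ∘ sprayVec ℓ from rfl,
    this.fderiv]
  rfl

/-- The geodesic vector field `(y, -2G)`. -/
def geodField (ℓ : Vec m × Vec m → ℝ) (p : Vec m × Vec m) : Vec m × Vec m :=
  (p.2, (-2 : ℝ) • sprayVec ℓ p)

/-- The horizontal lift `ξ ↦ ξ^j δ_j`. -/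
def hlift (ℓ : Vec m × Vec m → ℝ) (p : Vec m × Vec m) : Vec m →L[ℝ] Vec m × Vec m :=
  (ContinuousLinearMap.id ℝ _).prod
    (-(fderiv ℝ (sprayVec ℓ) p ∘L ContinuousLinearMap.inr ℝ (Vec m) (Vec m)))

lemma hlift_apply (ℓ : Vec m × Vec m → ℝ) (p : Vec m × Vec m) (ξ : Vec m) :
    hlift ℓ p ξ = (ξ, -fderiv ℝ (sprayVec ℓ) p (0, ξ)) := by
  simp [hlift]

lemma vert_add (ξ η : Vec m) : ((0 : Vec m), ξ + η) = (0, ξ) + (0, η) := by simp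

lemma vert_smul (c : ℝ) (ξ : Vec m) : ((0 : Vec m), c • ξ) = c • (0, ξ) := by simp

lemma pair_split_smul (ξ η : Vec m) (c : ℝ) :
    (ξ, c • η) = (ξ, (0 : Vec m)) + c • ((0 : Vec m), η) := by simp

lemma hlift_split (ℓ : Vec m × Vec m → ℝ) (p : Vec m × Vec m) (ξ : Vec m) :
    hlift ℓ p ξ = (ξ, 0) - (0, fderiv ℝ (sprayVec ℓ) p (0, ξ)) := by
  simp [hlift]

lemma geodField_split (ℓ : Vec m × Vec m → ℝ) (p : Vec m × Vec m) :
    geodField ℓ p = (p.2, 0) - (2 : ℝ) • (0, sprayVec ℓ p) := by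
  simp [geodField]

lemma hderiv_eq (h : IsLocalFinsler U ℓ) (hp : p ∈ U) (j : Fin m) (f : Vec m × Vec m → ℝ) :
    hderiv ℓ j f p = fderiv ℝ f p (hlift ℓ p (coordVec j)) := by
  rw [hlift_split, map_sub, hderiv, pdx, ← sum_vert]
  simp_rw [nonlin_eq h hp, pdy, mul_comm]

/-- Contraction of a bilinear form with two vectors. -/
lemma sum_coord_coord (b : Vec m → Vec m → ℝ) (h1 : ∀ η, IsLinearMap ℝ fun ξ => b ξ η)
    (h2 : ∀ ξ, IsLinearMap ℝ (b ξ)) (ξ η : Vec m) :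
    ∑ i, ∑ j, b (coordVec i) (coordVec j) * ξ i * η j = b ξ η := by
  have e1 : ∀ i, ∑ j, b (coordVec i) (coordVec j) * ξ i * η j = b (coordVec i) η * ξ i := by
    intro i
    rw [← show _ = b (coordVec i) η from sum_coord (h2 (coordVec i)).mk' η, Finset.sum_mul]
    exact Finset.sum_congr rfl fun j _ => by simp only [IsLinearMap.mk'_apply]; ring
  simp_rw [e1]
  exact sum_coord (h1 η).mk' ξ

/-- Lowering an index after raising it. -/
lemma sum_metric_raise (h : IsLocalFinsler U ℓ) (hp : p ∈ U) (N : Vec m) (A : Fin m → ℝ) :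
    ∑ i, (∑ j, metric ℓ i j p * N j) * ∑ s, invMetric ℓ i s p * A s = ∑ s, A s * N s := by
  have e : ∀ i, (∑ j, metric ℓ i j p * N j) * ∑ s, invMetric ℓ i s p * A s =
      ∑ j, ∑ s, N j * A s * (metric ℓ j i p * invMetric ℓ i s p) := by
    intro i
    rw [Finset.sum_mul_sum]
    refine Finset.sum_congr rfl fun j _ => Finset.sum_congr rfl fun s _ => ?_
    rw [metric_symm h hp j i]; ring
  simp_rw [e]
  rw [Finset.sum_comm]
  refine Finset.sum_congr rfl fun j _ => ?_
  rw [Finset.sum_comm]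
  simp_rw [← Finset.mul_sum, sum_metric_invMetric h hp]
  simp [mul_comm]

lemma sum_metric_spray (h : IsLocalFinsler U ℓ) (hp : p ∈ U) (N : Vec m) :
    d2 (energy ℓ) p (0, N) (0, sprayVec ℓ p) =
      (1 / 2) * (d2 (energy ℓ) p (p.2, 0) (0, N) - fderiv ℝ (energy ℓ) p (N, 0)) := by
  have hA : ∀ s, ∑ j, ∑ k, (pdx j (metric ℓ s k) p + pdx k (metric ℓ s j) p
      - pdx s (metric ℓ j k) p) * p.2 j * p.2 k =
      2 * (d2 (energy ℓ) p (p.2, 0) (0, coordVec s) - fderiv ℝ (energy ℓ) p (coordVec s, 0)) := by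
    intro s
    simp_rw [pdx, fderiv_metric h hp]
    rw [sum_coord_coord (fun ξ η => d3 (energy ℓ) p (ξ, 0) (0, coordVec s) (0, η) +
      d3 (energy ℓ) p (η, 0) (0, coordVec s) (0, ξ) -
      d3 (energy ℓ) p (coordVec s, 0) (0, ξ) (0, η))]
    · rw [h.d3_euler hp, h.d3_euler hp, h.d2_euler hp (coordVec s, 0)]
      simp only [Prod.mk_zero_zero, map_zero]
      ring
    · intro η
      constructor
      · intro a b
        rw [vert_add, show (a + b, (0 : Vec m)) = (a, 0) + (b, 0) by simp]
        simp only [map_add, add_apply]; ring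
      · intro c a
        rw [vert_smul, show (c • a, (0 : Vec m)) = c • (a, 0) by simp]
        simp only [map_smul, smul_apply, smul_eq_mul]; ring
    · intro η
      constructor
      · intro a b
        rw [vert_add, show (a + b, (0 : Vec m)) = (a, 0) + (b, 0) by simp]
        simp only [map_add, add_apply]; ring
      · intro c a
        rw [vert_smul, show (c • a, (0 : Vec m)) = c • (a, 0) by simp]
        simp only [map_smul, smul_apply, smul_eq_mul]; ring
  have hs : ∀ i, spray ℓ i p = ∑ s, invMetric ℓ i s p *
      ((1 / 2) * (d2 (energy ℓ) p (p.2, 0) (0, coordVec s) -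
        fderiv ℝ (energy ℓ) p (coordVec s, 0))) := by
    intro i
    have : ∀ s, invMetric ℓ i s p * ((1 / 2) * (d2 (energy ℓ) p (p.2, 0) (0, coordVec s) -
        fderiv ℝ (energy ℓ) p (coordVec s, 0))) = (1 / 4) * (invMetric ℓ i s p *
        ∑ j, ∑ k, (pdx j (metric ℓ s k) p + pdx k (metric ℓ s j) p
      - pdx s (metric ℓ j k) p) * p.2 j * p.2 k) := fun s => by rw [hA]; ring
    simp_rw [this, spray, christoffel, Finset.mul_sum, Finset.sum_mul, Finset.mul_sum]
    rw [Finset.sum_comm_cycle]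
    refine Finset.sum_congr rfl fun s _ => Finset.sum_congr rfl fun j _ =>
      Finset.sum_congr rfl fun k _ => ?_
    ring
  rw [d2_symm h.isOpen h.energy_smooth hp, ← sum_metric h hp]
  have e : ∀ i, ∑ j, metric ℓ i j p * sprayVec ℓ p i * N j =
      (∑ j, metric ℓ i j p * N j) * ∑ s, invMetric ℓ i s p *
      ((1 / 2) * (d2 (energy ℓ) p (p.2, 0) (0, coordVec s) -
        fderiv ℝ (energy ℓ) p (coordVec s, 0))) := by
    intro i
    rw [← hs, Finset.sum_mul]
    exact Finset.sum_congr rfl fun j _ => by simp only [sprayVec]; ring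
  simp_rw [e]
  rw [sum_metric_raise h hp, ← sum_vert (d2 (energy ℓ) p (p.2, 0)),
    ← show _ = fderiv ℝ (energy ℓ) p (N, 0) from
      sum_coord ((fderiv ℝ (energy ℓ) p).toLinearMap ∘ₗ LinearMap.inl ℝ (Vec m) (Vec m)) N,
    ← Finset.sum_sub_distrib, Finset.mul_sum]
  refine Finset.sum_congr rfl fun j _ => ?_
  simp; ring

/-- The Euler–Lagrange equation that characterizes the spray: the geodesic field `S = (y, -2G)`
satisfies `S (∂̇_i E) = ∂_i E` for the energy `E`. -/
lemma IsLocalFinsler.spray_eq (h : IsLocalFinsler U ℓ) (hp : p ∈ U) (ξ : Vec m) :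
    d2 (energy ℓ) p (geodField ℓ p) (0, ξ) = fderiv ℝ (energy ℓ) p (ξ, 0) := by
  rw [geodField_split, map_sub, map_smul, sub_apply, smul_apply, smul_eq_mul,
    d2_symm h.isOpen h.energy_smooth hp (0, sprayVec ℓ p), sum_metric_spray h hp]
  ring

/-- First vertical derivative of the Euler–Lagrange equation. -/
lemma IsLocalFinsler.spray_eq_deriv (h : IsLocalFinsler U ℓ) (hp : p ∈ U) (ξ η : Vec m) :
    d3 (energy ℓ) p (0, η) (geodField ℓ p) (0, ξ) + d2 (energy ℓ) p (η, 0) (0, ξ) -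
      2 * d2 (energy ℓ) p (0, fderiv ℝ (sprayVec ℓ) p (0, η)) (0, ξ) =
      d2 (energy ℓ) p (0, η) (ξ, 0) := by
  have hγ := hasDerivAt_line p (0, η)
  have hp' : p + (0 : ℝ) • ((0 : Vec m), η) ∈ U := by simpa using hp
  have hS : HasDerivAt (fun t : ℝ => geodField ℓ (p + t • (0, η)))
      (η, (-2 : ℝ) • fderiv ℝ (sprayVec ℓ) p (0, η)) 0 := by
    have := hasDerivAt_d0 h.isOpen (sprayVec_smooth h) hγ hp'
    refine HasDerivAt.prodMk (by simpa using hasDerivAt_line p.2 η) ?_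
    simpa using this.fun_const_smul (-2 : ℝ)
  have key := deriv_unique_of_eqOn h.isOpen hγ hp' (fun t ht => h.spray_eq ht ξ)
    (hasDerivAt_d2 h.isOpen h.energy_smooth hγ hp' hS (hasDerivAt_const _ _))
    (hasDerivAt_d1 h.isOpen h.energy_smooth hγ hp' (hasDerivAt_const _ _))
  simp only [zero_smul, add_zero, map_zero, pair_split_smul, map_add, map_smul, add_apply,
    smul_apply, smul_eq_mul] at key
  linarith

/-- Second vertical derivative of the Euler–Lagrange equation. -/
lemma IsLocalFinsler.spray_eq_deriv₂ (h : IsLocalFinsler U ℓ) (hp : p ∈ U) (ξ η ζ : Vec m) :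
    d4 (energy ℓ) p (0, ζ) (0, η) (geodField ℓ p) (0, ξ) +
      d3 (energy ℓ) p (0, η) (ζ, 0) (0, ξ) -
      2 * d3 (energy ℓ) p (0, η) (0, fderiv ℝ (sprayVec ℓ) p (0, ζ)) (0, ξ) +
      d3 (energy ℓ) p (0, ζ) (η, 0) (0, ξ) -
      2 * d3 (energy ℓ) p (0, ζ) (0, fderiv ℝ (sprayVec ℓ) p (0, η)) (0, ξ) -
      2 * d2 (energy ℓ) p (0, d2 (sprayVec ℓ) p (0, ζ) (0, η)) (0, ξ) =
      d3 (energy ℓ) p (0, ζ) (0, η) (ξ, 0) := by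
  have hγ := hasDerivAt_line p (0, ζ)
  have hp' : p + (0 : ℝ) • ((0 : Vec m), ζ) ∈ U := by simpa using hp
  have hS : HasDerivAt (fun t : ℝ => geodField ℓ (p + t • (0, ζ)))
      (ζ, (-2 : ℝ) • fderiv ℝ (sprayVec ℓ) p (0, ζ)) 0 := by
    have := hasDerivAt_d0 h.isOpen (sprayVec_smooth h) hγ hp'
    refine HasDerivAt.prodMk (by simpa using hasDerivAt_line p.2 ζ) ?_
    simpa using this.fun_const_smul (-2 : ℝ)
  have hG : HasDerivAt (fun t : ℝ => ((0 : Vec m),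
      fderiv ℝ (sprayVec ℓ) (p + t • (0, ζ)) (0, η)))
      (0, d2 (sprayVec ℓ) p (0, ζ) (0, η)) 0 := by
    refine (hasDerivAt_const _ _).prodMk ?_
    simpa using hasDerivAt_d1 h.isOpen (sprayVec_smooth h) hγ hp' (hasDerivAt_const _ (0, η))
  have c : ∀ w : Vec m × Vec m, HasDerivAt (fun _ : ℝ => w) 0 0 := hasDerivAt_const _
  have key := deriv_unique_of_eqOn h.isOpen hγ hp' (fun t ht => h.spray_eq_deriv ht ξ η)
    (((hasDerivAt_d3 h.isOpen h.energy_smooth hγ hp' (c _) hS (c _)).add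
      (hasDerivAt_d2 h.isOpen h.energy_smooth hγ hp' (c _) (c _))).sub
      ((hasDerivAt_d2 h.isOpen h.energy_smooth hγ hp' hG (c _)).const_mul 2))
    (hasDerivAt_d2 h.isOpen h.energy_smooth hγ hp' (c _) (c _))
  simp only [zero_smul, add_zero, map_zero, pair_split_smul, map_add, map_smul, add_apply,
    smul_apply, smul_eq_mul, zero_apply] at key
  rw [d3_symm₁₂ h.isOpen h.energy_smooth hp (0, ζ)  (0, fderiv ℝ (sprayVec ℓ) p (0, η)),
    d3_symm₁₂ h.isOpen h.energy_smooth hp (0, ζ) (η, 0)]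
  rw [d3_symm₁₂ h.isOpen h.energy_smooth hp (0, ζ)  (0, fderiv ℝ (sprayVec ℓ) p (0, η)),
    d3_symm₁₂ h.isOpen h.energy_smooth hp (0, ζ) (η, 0)] at key
  linarith

/-- Metric compatibility along the geodesic field:
`S g_ij = g_rj G^r_i + g_ir G^r_j`. -/
lemma IsLocalFinsler.geod_metric (h : IsLocalFinsler U ℓ) (hp : p ∈ U) (ξ η : Vec m) :
    d3 (energy ℓ) p (geodField ℓ p) (0, ξ) (0, η) =
      d2 (energy ℓ) p (0, fderiv ℝ (sprayVec ℓ) p (0, ξ)) (0, η) +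
      d2 (energy ℓ) p (0, ξ) (0, fderiv ℝ (sprayVec ℓ) p (0, η)) := by
  have h1 := h.spray_eq_deriv hp ξ η
  have h2 := h.spray_eq_deriv hp η ξ
  rw [d3_symm₁₂ h.isOpen h.energy_smooth hp, d2_symm h.isOpen h.energy_smooth hp (η, 0),
    d3_symm₂₃ h.isOpen h.energy_smooth hp,
    d2_symm h.isOpen h.energy_smooth hp _ (0, ξ)] at h1
  rw [d3_symm₁₂ h.isOpen h.energy_smooth hp, d2_symm h.isOpen h.energy_smooth hp (ξ, 0)] at h2
  have e1 := d2_symm h.isOpen h.energy_smooth hp (0, ξ) (η, 0)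
  have e2 := d2_symm h.isOpen h.energy_smooth hp (0, η) (ξ, 0)
  linarith

/-- The Cartan coefficients `F_ijk` (on the left) differ from the Berwald coefficients
`g_ir ∂̇_k G^r_j` by the tensor `P_ijk = C_{ijk|0}`, here written as the derivative of `C` along the
geodesic field, corrected by the nonlinear connection. -/
lemma IsLocalFinsler.cartan_berwald (h : IsLocalFinsler U ℓ) (hp : p ∈ U) (N ξ η : Vec m) :
    (1 / 2) * (d3 (energy ℓ) p (hlift ℓ p ξ) (0, N) (0, η) +
        d3 (energy ℓ) p (hlift ℓ p η) (0, N) (0, ξ) -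
        d3 (energy ℓ) p (hlift ℓ p N) (0, ξ) (0, η)) =
      d2 (energy ℓ) p (0, N) (0, d2 (sprayVec ℓ) p (0, η) (0, ξ)) -
      (1 / 2) * (d4 (energy ℓ) p (geodField ℓ p) (0, N) (0, ξ) (0, η) -
        d3 (energy ℓ) p (0, fderiv ℝ (sprayVec ℓ) p (0, N)) (0, ξ) (0, η) -
        d3 (energy ℓ) p (0, N) (0, fderiv ℝ (sprayVec ℓ) p (0, ξ)) (0, η) -
        d3 (energy ℓ) p (0, N) (0, ξ) (0, fderiv ℝ (sprayVec ℓ) p (0, η))) := by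
  have hU := h.isOpen
  have hE := h.energy_smooth
  have hs := h.spray_eq_deriv₂ hp N ξ η
  have s12 := fun a b c => d3_symm₁₂ hU hE hp a b c
  have s23 := fun a b c => d3_symm₂₃ hU hE hp a b c
  -- all derivatives are brought to one order of the arguments
  have e0 : d4 (energy ℓ) p (0, η) (0, ξ) (geodField ℓ p) (0, N) =
      d4 (energy ℓ) p (geodField ℓ p) (0, N) (0, ξ) (0, η) := by
    rw [d4_symm₂₃ hU hE hp, d4_symm₁₂ hU hE hp, d4_symm₃₄ hU hE hp, d4_symm₂₃ hU hE hp,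
      d4_symm₃₄ hU hE hp]
  have e1 : ∀ ξ η : Vec m, d3 (energy ℓ) p (0, ξ) (η, 0) (0, N) =
      d3 (energy ℓ) p (η, 0) (0, N) (0, ξ) := fun ξ η => by rw [s12, s23]
  have e2 : ∀ ξ η : Vec m, d3 (energy ℓ) p (0, ξ) (0, η) (0, N) =
      d3 (energy ℓ) p (0, N) (0, ξ) (0, η) := fun ξ η => by rw [s23, s12]
  have e3 : ∀ ξ η : Vec m, d3 (energy ℓ) p (0, ξ) (0, N) (0, η) =
      d3 (energy ℓ) p (0, N) (0, ξ) (0, η) := fun ξ η => by rw [s12]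
  have e4 : d3 (energy ℓ) p (0, η) (0, ξ) (N, 0) =
      d3 (energy ℓ) p (N, 0) (0, ξ) (0, η) := by rw [s23, s12, s23]
  have e5 := s23 (0, N) (0, η) (0, fderiv ℝ (sprayVec ℓ) p (0, ξ))
  have e6 := s23 (0, N) (0, ξ) (0, fderiv ℝ (sprayVec ℓ) p (0, η))
  have e7 := d2_symm hU hE hp (0, N) (0, d2 (sprayVec ℓ) p (0, η) (0, ξ))
  rw [e0, e1, e1, e2, e2, e4] at hs
  simp only [hlift_split, map_sub, sub_apply]
  rw [e3, e3]
  linarith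

/-- `G^i_j y^j = 2 G^i`. -/
lemma IsLocalFinsler.nonlin_radial (h : IsLocalFinsler U ℓ) (hp : p ∈ U) :
    fderiv ℝ (sprayVec ℓ) p (0, p.2) = (2 : ℝ) • sprayVec ℓ p := by
  have key : ∀ ξ, d2 (energy ℓ) p (0, fderiv ℝ (sprayVec ℓ) p (0, p.2) - (2 : ℝ) • sprayVec ℓ p)
      (0, ξ) = 0 := by
    intro ξ
    have h1 := h.spray_eq_deriv hp ξ p.2
    have h2 := h.spray_eq hp ξ
    have h3 := h.d3_euler hp (geodField ℓ p) (0, ξ)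
    have h4 := h.d2_euler hp (ξ, 0)
    have h5 := sum_metric_spray h hp ξ
    rw [d3_symm₁₂ h.isOpen h.energy_smooth hp, d3_symm₂₃ h.isOpen h.energy_smooth hp, h3, h2,
      d2_symm h.isOpen h.energy_smooth hp (0, p.2), h4] at h1
    simp only [geodField, vert_smul, map_smul, smul_eq_mul, Prod.mk_zero_zero, map_zero] at h1
    rw [sub_eq_add_neg, vert_add, map_add, ← neg_smul, vert_smul, map_smul]
    simp only [add_apply, smul_apply, smul_eq_mul]
    rw [d2_symm h.isOpen h.energy_smooth hp (0, sprayVec ℓ p)]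
    linarith
  by_contra hne
  exact (metric_pos h hp (sub_ne_zero.2 hne)).ne' (key _)

/-- Contraction of the Cartan connection coefficients, with the upper index lowered by the
metric. -/
lemma sum_cartanConn (h : IsLocalFinsler U ℓ) (hp : p ∈ U) (N ξ η : Vec m) :
    ∑ i, (∑ j, metric ℓ i j p * N j) * ∑ j, ∑ k, cartanConn ℓ i j k p * ξ j * η k =
      (1 / 2) * (d3 (energy ℓ) p (hlift ℓ p ξ) (0, N) (0, η) +
        d3 (energy ℓ) p (hlift ℓ p η) (0, N) (0, ξ) -
        d3 (energy ℓ) p (hlift ℓ p N) (0, ξ) (0, η)) := by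
  set T : Fin m → Vec m → Vec m → ℝ := fun s ξ η =>
    d3 (energy ℓ) p (hlift ℓ p ξ) (0, coordVec s) (0, η) +
      d3 (energy ℓ) p (hlift ℓ p η) (0, coordVec s) (0, ξ) -
      d3 (energy ℓ) p (hlift ℓ p (coordVec s)) (0, ξ) (0, η) with hT
  have hT1 : ∀ s ξ η, ∑ j, ∑ k, T s (coordVec j) (coordVec k) * ξ j * η k = T s ξ η := by
    intro s ξ η
    refine sum_coord_coord (T s) (fun η => ⟨?_, ?_⟩) (fun ξ => ⟨?_, ?_⟩) ξ η
    · intro a b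
      simp only [hT, vert_add, map_add, add_apply]; ring
    · intro c a
      simp only [hT, vert_smul, map_smul, smul_apply, smul_eq_mul]; ring
    · intro a b
      simp only [hT, vert_add, map_add, add_apply]; ring
    · intro c a
      simp only [hT, vert_smul, map_smul, smul_apply, smul_eq_mul]; ring
  have e : ∀ i, ∑ j, ∑ k, cartanConn ℓ i j k p * ξ j * η k =
      ∑ s, invMetric ℓ i s p * ((1 / 2) * T s ξ η) := by
    intro i
    have : ∀ s, invMetric ℓ i s p * ((1 / 2) * T s ξ η) =
        (1 / 2) * (invMetric ℓ i s p *
          ∑ j, ∑ k, T s (coordVec j) (coordVec k) * ξ j * η k) := fun s => by rw [hT1]; ring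
    simp_rw [this, cartanConn, hderiv_eq h hp, fderiv_metric h hp, Finset.mul_sum, Finset.sum_mul]
    rw [Finset.sum_comm_cycle]
    refine Finset.sum_congr rfl fun s _ => Finset.sum_congr rfl fun j _ =>
      Finset.sum_congr rfl fun k _ => ?_
    simp only [hT]; ring
  simp_rw [e]
  rw [sum_metric_raise h hp]
  have hl : IsLinearMap ℝ fun N : Vec m => (1 / 2) * (d3 (energy ℓ) p (hlift ℓ p ξ) (0, N) (0, η) +
        d3 (energy ℓ) p (hlift ℓ p η) (0, N) (0, ξ) -
        d3 (energy ℓ) p (hlift ℓ p N) (0, ξ) (0, η)) := by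
    constructor
    · intro a b
      simp only [vert_add, map_add, add_apply]; ring
    · intro c a
      simp only [vert_smul, map_smul, smul_apply, smul_eq_mul]; ring
  exact sum_coord hl.mk' N

end Spray

/-! ### Hypersurfaces in a chart -/

/-- An immersed hypersurface `x^i = x^i(u^α)`, parametrized by the open set `O`. -/
structure IsLocalHypersurface {n : ℕ} (O : Set (Vec n)) (x : Vec n → Vec (n + 1)) : Prop where
  isOpen : IsOpen O
  smooth : ContDiffOn ℝ ∞ x O
  immersion : ∀ u ∈ O, Function.Injective (fderiv ℝ x u)

/-- The coordinates `(u, v)` of the supporting elements. -/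
def supportSet {n m : ℕ} (O : Set (Vec n)) (U : Set (Vec m × Vec m)) (x : Vec n → Vec m) :
    Set (Vec n × Vec n) :=
  {q | q.1 ∈ O ∧ support x q.1 q.2 ∈ U}

/-- The components of the covector `ξ ↦ det (ξ, B_1, …, B_n)`, which depends on the point `u` only
and not on the supporting element. -/
def coNormalVec {n : ℕ} (x : Vec n → Vec (n + 1)) (u : Vec n) (i : Fin (n + 1)) : ℝ :=
  (-1) ^ (i : ℕ) * (Matrix.of fun α j : Fin n => fderiv ℝ x u (coordVec α) (i.succAbove j)).det

/-- The covector `ξ ↦ det (ξ, B_1, …, B_n)`, whose kernel is the tangent space of the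
hypersurface. -/
def coNormal {n : ℕ} (x : Vec n → Vec (n + 1)) (u : Vec n) : Vec (n + 1) →L[ℝ] ℝ :=
  ∑ i, coNormalVec x u i • EuclideanSpace.proj i

/-- The normal vector field of the hypersurface obtained by raising the index of `coNormal`; it
depends smoothly on the supporting element and is not normalized. -/
def normalVec {n : ℕ} (ℓ : Vec (n + 1) × Vec (n + 1) → ℝ) (x : Vec n → Vec (n + 1))
    (q : Vec n × Vec n) : Vec (n + 1) :=
  WithLp.toLp 2 fun i => ∑ j, invMetric ℓ i j (support x q.1 q.2) * coNormalVec x q.1 j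

section LocalHypersurface

variable {n : ℕ} {O : Set (Vec n)} {x : Vec n → Vec (n + 1)}
  {U : Set (Vec (n + 1) × Vec (n + 1))} {ℓ ℓ' : Vec (n + 1) × Vec (n + 1) → ℝ} {u : Vec n}
  {q : Vec n × Vec n}

lemma coNormal_apply (x : Vec n → Vec (n + 1)) (u : Vec n) (ξ : Vec (n + 1)) :
    coNormal x u ξ = ∑ i, coNormalVec x u i * ξ i := by
  simp [coNormal]

/-- The Laplace expansion along the first row. -/
lemma coNormal_eq_det (x : Vec n → Vec (n + 1)) (u : Vec n) (ξ : Vec (n + 1)) :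
    coNormal x u ξ = (Matrix.of (Fin.cons (fun i => ξ i)
      (fun α i => fderiv ℝ x u (coordVec α) i) : Fin (n + 1) → Fin (n + 1) → ℝ)).det := by
  rw [Matrix.det_succ_row_zero, coNormal_apply]
  refine Finset.sum_congr rfl fun i _ => ?_
  rw [coNormalVec, mul_right_comm]
  rfl

lemma coNormal_tangent (x : Vec n → Vec (n + 1)) (u a : Vec n) :
    coNormal x u (fderiv ℝ x u a) = 0 := by
  have h : ∀ α, coNormal x u (fderiv ℝ x u (coordVec α)) = 0 := by
    intro α
    rw [coNormal_eq_det]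
    exact Matrix.det_zero_of_row_eq (Fin.succ_ne_zero α).symm (by ext i; simp)
  rw [← show _ = coNormal x u (fderiv ℝ x u a) from
    sum_coord ((coNormal x u).toLinearMap ∘ₗ (fderiv ℝ x u).toLinearMap) a]
  exact Finset.sum_eq_zero fun α _ => by
    simp only [LinearMap.comp_apply, ContinuousLinearMap.coe_coe, h, zero_mul]

lemma coNormal_ker (hinj : Function.Injective (fderiv ℝ x u)) {ξ : Vec (n + 1)}
    (hξ : coNormal x u ξ = 0) : ∃ a, fderiv ℝ x u a = ξ := by
  rw [coNormal_eq_det] at hξ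
  obtain ⟨c, hc, h0⟩ := Matrix.exists_vecMul_eq_zero_iff.2 hξ
  set a : Vec n := WithLp.toLp 2 fun α => c α.succ with ha
  have e : c 0 • ξ + fderiv ℝ x u a = 0 := by
    ext i
    have h1 := congrFun h0 i
    rw [Matrix.vecMul, dotProduct, Fin.sum_univ_succ] at h1
    have h2 : ∑ α, fderiv ℝ x u (coordVec α) i * a α = fderiv ℝ x u a i :=
      sum_coord ((EuclideanSpace.proj (𝕜 := ℝ) i).toLinearMap ∘ₗ (fderiv ℝ x u).toLinearMap) a
    rw [PiLp.add_apply, PiLp.smul_apply, smul_eq_mul, PiLp.zero_apply, ← h2]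
    simpa [ha, mul_comm] using h1
  by_cases hc0 : c 0 = 0
  · rw [hc0, zero_smul, zero_add] at e
    have : a = 0 := hinj (by rw [e, map_zero])
    refine absurd ?_ hc
    ext i
    refine Fin.cases hc0 (fun α => ?_) i
    simpa [ha] using congrArg (fun w : Vec n => w α) this
  · refine ⟨-(c 0)⁻¹ • a, ?_⟩
    rw [map_smul, eq_neg_of_add_eq_zero_right e, smul_neg, neg_smul, neg_neg, smul_smul,
      inv_mul_cancel₀ hc0, one_smul]

lemma exists_coNormal_eq_one (hinj : Function.Injective (fderiv ℝ x u)) :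
    ∃ ξ, coNormal x u ξ = 1 := by
  by_contra! hne
  have hz : ∀ ξ, coNormal x u ξ = 0 := by
    intro ξ
    by_contra h0
    exact hne ((coNormal x u ξ)⁻¹ • ξ) (by simp [h0])
  have hs : Function.Surjective (fderiv ℝ x u).toLinearMap := fun ξ => coNormal_ker hinj (hz ξ)
  have := LinearMap.finrank_le_finrank_of_surjective hs
  simp at this

lemma metric_normalVec (h : IsLocalFinsler U ℓ) (hq : support x q.1 q.2 ∈ U) (ξ : Vec (n + 1)) :
    d2 (energy ℓ) (support x q.1 q.2) (0, normalVec ℓ x q) (0, ξ) = coNormal x q.1 ξ := by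
  rw [← sum_metric h hq, coNormal_apply, ← sum_metric_raise h hq]
  refine Finset.sum_congr rfl fun i _ => ?_
  rw [Finset.sum_mul]
  exact Finset.sum_congr rfl fun j _ => by simp only [normalVec]; ring

lemma normalVec_ne_zero (h : IsLocalFinsler U ℓ) (hq : support x q.1 q.2 ∈ U)
    (hinj : Function.Injective (fderiv ℝ x q.1)) : normalVec ℓ x q ≠ 0 := by
  obtain ⟨ξ, hξ⟩ := exists_coNormal_eq_one hinj
  intro h0
  have := metric_normalVec h hq ξ
  rw [h0, hξ, Prod.mk_zero_zero, map_zero] at this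
  simp at this

lemma metric_normal_eq (hinj : Function.Injective (fderiv ℝ x u))
    {A : Vec (n + 1) × Vec (n + 1) →L[ℝ] ℝ} (hA : ∀ a, A (0, fderiv ℝ x u a) = 0) :
    ∃ c, ∀ ξ, A (0, ξ) = c * coNormal x u ξ := by
  obtain ⟨ξ₀, hξ₀⟩ := exists_coNormal_eq_one hinj
  refine ⟨A (0, ξ₀), fun ξ => ?_⟩
  obtain ⟨a, ha⟩ := coNormal_ker hinj (ξ := ξ - coNormal x u ξ • ξ₀) (by simp [hξ₀])
  have := hA a
  rw [ha, sub_eq_add_neg, ← neg_smul, vert_add, vert_smul, map_add, map_smul, smul_eq_mul] at this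
  linarith

/-- A vector orthogonal to the tangent space is a multiple of `normalVec`. -/
lemma eq_smul_normalVec (h : IsLocalFinsler U ℓ) (hq : support x q.1 q.2 ∈ U)
    (hinj : Function.Injective (fderiv ℝ x q.1)) {N : Vec (n + 1)}
    (hN : ∀ a, d2 (energy ℓ) (support x q.1 q.2) (0, N) (0, fderiv ℝ x q.1 a) = 0) :
    ∃ c : ℝ, N = c • normalVec ℓ x q := by
  obtain ⟨c, hc⟩ := metric_normal_eq hinj hN
  refine ⟨c, ?_⟩
  by_contra hne
  refine (metric_pos h hq (sub_ne_zero.2 hne)).ne' ?_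
  have key : ∀ ξ, d2 (energy ℓ) (support x q.1 q.2) (0, N - c • normalVec ℓ x q) (0, ξ) = 0 := by
    intro ξ
    rw [sub_eq_add_neg, ← neg_smul, vert_add, vert_smul, map_add, map_smul, add_apply, smul_apply,
      metric_normalVec h hq, hc, smul_eq_mul]
    ring
  exact key _

lemma IsLocalHypersurface.support_smooth (hx : IsLocalHypersurface O x) :
    ContDiffOn ℝ ∞ (fun q : Vec n × Vec n => support x q.1 q.2) (O ×ˢ Set.univ) := by
  have h1 : ContDiffOn ℝ ∞ (fun q : Vec n × Vec n => q.1) (O ×ˢ Set.univ) := contDiffOn_fst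
  have hm : Set.MapsTo (fun q : Vec n × Vec n => q.1) (O ×ˢ Set.univ) O := fun q hq => hq.1
  exact (hx.smooth.comp h1 hm).prodMk
    (((smoothOn_fderiv hx.isOpen hx.smooth).comp h1 hm).clm_apply contDiffOn_snd)

lemma IsLocalHypersurface.isOpen_supportSet (hx : IsLocalHypersurface O x) (hU : IsOpen U) :
    IsOpen (supportSet O U x) := by
  have := hx.support_smooth.continuousOn.isOpen_inter_preimage (hx.isOpen.prod isOpen_univ) hU
  have e : supportSet O U x = O ×ˢ Set.univ ∩ (fun q => support x q.1 q.2) ⁻¹' U := by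
    ext q
    simp only [supportSet, Set.mem_ofPred_eq, Set.mem_inter_iff, Set.mem_prod, Set.mem_univ,
      and_true, Set.mem_preimage]
  rwa [e]

lemma normalVec_smooth (hx : IsLocalHypersurface O x) (h : IsLocalFinsler U ℓ) :
    ContDiffOn ℝ ∞ (normalVec ℓ x) (supportSet O U x) := by
  have hs : ContDiffOn ℝ ∞ (fun q : Vec n × Vec n => support x q.1 q.2) (supportSet O U x) :=
    hx.support_smooth.mono fun q hq => ⟨hq.1, trivial⟩
  refine contDiffOn_euclidean.2 fun i => ?_
  simp only [normalVec]
  refine ContDiffOn.sum fun j _ => ?_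
  refine ((invMetric_smooth h i j).comp hs fun q hq => hq.2).mul
    (contDiffOn_const.mul (contDiffOn_det fun α k => ?_))
  have h1 : ContDiffOn ℝ ∞ (fun q : Vec n × Vec n => fderiv ℝ x q.1 (coordVec α))
      (supportSet O U x) :=
    ((smoothOn_fderiv hx.isOpen hx.smooth).comp contDiffOn_fst fun q hq => hq.1).clm_apply
      contDiffOn_const
  exact (EuclideanSpace.proj (𝕜 := ℝ) (j.succAbove k)).contDiff.comp_contDiffOn h1

/-- The derivative of the supporting element in the direction `(a, b)`. -/
lemma IsLocalHypersurface.hasDerivAt_support (hx : IsLocalHypersurface O x) (hq : q.1 ∈ O)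
    (a b : Vec n) :
    HasDerivAt (fun t : ℝ => support x (q + t • (a, b)).1 (q + t • (a, b)).2)
      (fderiv ℝ x q.1 a, d2 x q.1 a q.2 + fderiv ℝ x q.1 b) 0 := by
  have h1 : HasDerivAt (fun t : ℝ => (q + t • (a, b)).1) a 0 := by
    simpa using hasDerivAt_line q.1 a
  have h2 : HasDerivAt (fun t : ℝ => (q + t • (a, b)).2) b 0 := by
    simpa using hasDerivAt_line q.2 b
  have h0 : (q + (0 : ℝ) • (a, b)).1 ∈ O := by simpa using hq
  refine HasDerivAt.prodMk ?_ ?_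
  · simpa using hasDerivAt_d0 hx.isOpen hx.smooth h1 h0
  · simpa using hasDerivAt_d1 hx.isOpen hx.smooth h1 h0 h2

lemma IsLocalHypersurface.hasDerivAt_tangent (hx : IsLocalHypersurface O x) (hq : q.1 ∈ O)
    (a b c : Vec n) :
    HasDerivAt (fun t : ℝ => ((0 : Vec (n + 1)), fderiv ℝ x (q + t • (a, b)).1 c))
      (0, d2 x q.1 a c) 0 := by
  have h1 : HasDerivAt (fun t : ℝ => (q + t • (a, b)).1) a 0 := by
    simpa using hasDerivAt_line q.1 a
  have h0 : (q + (0 : ℝ) • (a, b)).1 ∈ O := by simpa using hq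
  refine (hasDerivAt_const _ _).prodMk ?_
  simpa using hasDerivAt_d1 hx.isOpen hx.smooth h1 h0 (hasDerivAt_const _ c)

end LocalHypersurface

/-! ### Hypersurfaces containing their geodesics -/

/-- The geodesics of the ambient space that are tangent to the hypersurface stay in it:
`N_i (B^i_αβ v^α v^β + 2 G^i) = 0`, that is, `H_α v^α = 0`. -/
def IsGeodesicLocal {n : ℕ} (O : Set (Vec n)) (U : Set (Vec (n + 1) × Vec (n + 1)))
    (x : Vec n → Vec (n + 1)) (ℓ : Vec (n + 1) × Vec (n + 1) → ℝ) : Prop :=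
  ∀ q ∈ supportSet O U x,
    coNormal x q.1 (d2 x q.1 q.2 q.2 + (2 : ℝ) • sprayVec ℓ (support x q.1 q.2)) = 0

/-- `C_ijk N^i B^j_α B^k_β = 0`, with the normal vector `normalVec`. -/
def VTensorVanishesLocal {n : ℕ} (O : Set (Vec n)) (U : Set (Vec (n + 1) × Vec (n + 1)))
    (x : Vec n → Vec (n + 1)) (ℓ : Vec (n + 1) × Vec (n + 1) → ℝ) : Prop :=
  ∀ q ∈ supportSet O U x, ∀ a b, d3 (energy ℓ) (support x q.1 q.2) (0, normalVec ℓ x q)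
    (0, fderiv ℝ x q.1 a) (0, fderiv ℝ x q.1 b) = 0

section Geodesic

variable {n : ℕ} {O : Set (Vec n)} {x : Vec n → Vec (n + 1)}
  {U : Set (Vec (n + 1) × Vec (n + 1))} {ℓ ℓ' : Vec (n + 1) × Vec (n + 1) → ℝ} {u : Vec n}
  {q : Vec n × Vec n}

lemma mem_line_zero {E : Type*} [NormedAddCommGroup E] [NormedSpace ℝ E] {s : Set E} {p w : E}
    (hp : p ∈ s) : p + (0 : ℝ) • w ∈ s := by simpa using hp

/-- `N_i (B^i_βα v^β + G^i_j B^j_α) = 0`: the first derivative in `v` of the geodesic condition.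
The covector `N_i` may be kept constant because up to a factor it depends on `u` only. -/
lemma IsGeodesicLocal.deriv (hx : IsLocalHypersurface O x) (h : IsLocalFinsler U ℓ)
    (hg : IsGeodesicLocal O U x ℓ) (hq : q ∈ supportSet O U x) (a : Vec n) :
    coNormal x q.1 (d2 x q.1 q.2 a +
      fderiv ℝ (sprayVec ℓ) (support x q.1 q.2) (0, fderiv ℝ x q.1 a)) = 0 := by
  have hγ := hasDerivAt_line q (0, a)
  have hs := hx.hasDerivAt_support hq.1 0 a
  have hv : HasDerivAt (fun t : ℝ => (q + t • ((0 : Vec n), a)).2) a 0 := by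
    simpa using hasDerivAt_line q.2 a
  have h1 : HasDerivAt (fun t : ℝ => d2 x q.1 (q + t • ((0 : Vec n), a)).2)
      (d2 x q.1 a) 0 := (d2 x q.1).hasFDerivAt.comp_hasDerivAt (0 : ℝ) hv
  have h2 := h1.clm_apply hv
  have h3 := (hasDerivAt_d0 h.isOpen (sprayVec_smooth h) hs (by simpa using hq.2)).fun_const_smul
    (2 : ℝ)
  have h4 := (coNormal x q.1).hasFDerivAt.comp_hasDerivAt (0 : ℝ) (h2.add h3)
  have key := deriv_unique_of_eqOn (hx.isOpen_supportSet h.isOpen) hγ (mem_line_zero hq)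
    (ψ := fun _ => (0 : ℝ)) (fun t ht => ?_) h4 (hasDerivAt_const _ _)
  · simp only [zero_smul, add_zero, map_zero, zero_apply, zero_add] at key
    rw [d2_symm hx.isOpen hx.smooth hq.1 a] at key
    simp only [map_add, map_smul, smul_eq_mul] at key ⊢
    linarith
  · have := hg _ ht
    simpa using this

/-- `N_i (B^i_αβ + G^i_jk B^j_α B^k_β) = 0` for the Berwald coefficients `G^i_jk = ∂̇_k G^i_j`:
the second derivative in `v` of the geodesic condition. -/
lemma IsGeodesicLocal.deriv₂ (hx : IsLocalHypersurface O x) (h : IsLocalFinsler U ℓ)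
    (hg : IsGeodesicLocal O U x ℓ) (hq : q ∈ supportSet O U x) (a b : Vec n) :
    coNormal x q.1 (d2 x q.1 a b +
      d2 (sprayVec ℓ) (support x q.1 q.2) (0, fderiv ℝ x q.1 a) (0, fderiv ℝ x q.1 b)) = 0 := by
  have hγ := hasDerivAt_line q (0, a)
  have hs := hx.hasDerivAt_support hq.1 0 a
  have hv : HasDerivAt (fun t : ℝ => (q + t • ((0 : Vec n), a)).2) a 0 := by
    simpa using hasDerivAt_line q.2 a
  have h1 : HasDerivAt (fun t : ℝ => d2 x q.1 (q + t • ((0 : Vec n), a)).2)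
      (d2 x q.1 a) 0 := (d2 x q.1).hasFDerivAt.comp_hasDerivAt (0 : ℝ) hv
  have h2 := h1.clm_apply (hasDerivAt_const _ b)
  have h3 := hasDerivAt_d1 h.isOpen (sprayVec_smooth h) hs (by simpa using hq.2)
    (hasDerivAt_const _ ((0 : Vec (n + 1)), fderiv ℝ x q.1 b))
  have h4 := (coNormal x q.1).hasFDerivAt.comp_hasDerivAt (0 : ℝ) (h2.add h3)
  have key := deriv_unique_of_eqOn (hx.isOpen_supportSet h.isOpen) hγ (mem_line_zero hq)
    (ψ := fun _ => (0 : ℝ)) (fun t ht => ?_) h4 (hasDerivAt_const _ _)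
  · simpa using key
  · have := hg.deriv hx h ht b
    simpa using this

/-- If `C_ijk N^i B^j_α B^k_β = 0` and the hypersurface contains its geodesics, then
`N_i (B^i_αβ + F^i_jk B^j_α B^k_β) = 0` for the Cartan connection `F^i_jk`.

The Cartan and Berwald coefficients differ by the tensor `P = C_{|0}`, and `P (N, B_α, B_β) = 0`:
the hypersurface is preserved by parallel transport along its geodesics, so that
`C (N, B_α, B_β) = 0` may be differentiated along them. -/
lemma IsGeodesicLocal.secondFund_eq_zero (hx : IsLocalHypersurface O x) (h : IsLocalFinsler U ℓ)
    (hg : IsGeodesicLocal O U x ℓ) (hM : VTensorVanishesLocal O U x ℓ)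
    (hq : q ∈ supportSet O U x) (a b : Vec n) :
    coNormal x q.1 (d2 x q.1 a b) + (1 / 2) *
      (d3 (energy ℓ) (support x q.1 q.2) (hlift ℓ (support x q.1 q.2) (fderiv ℝ x q.1 a))
          (0, normalVec ℓ x q) (0, fderiv ℝ x q.1 b) +
        d3 (energy ℓ) (support x q.1 q.2) (hlift ℓ (support x q.1 q.2) (fderiv ℝ x q.1 b))
          (0, normalVec ℓ x q) (0, fderiv ℝ x q.1 a) -
        d3 (energy ℓ) (support x q.1 q.2) (hlift ℓ (support x q.1 q.2) (normalVec ℓ x q))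
          (0, fderiv ℝ x q.1 a) (0, fderiv ℝ x q.1 b)) = 0 := by
  have hU := h.isOpen
  have hE := h.energy_smooth
  have hinj := hx.immersion q.1 hq.1
  have hp := hq.2
  have hS := hx.isOpen_supportSet hU
  -- the direction `(v, k)` in which the supporting element moves along the geodesic field
  obtain ⟨k, hk⟩ := coNormal_ker hinj
    (ξ := -(d2 x q.1 q.2 q.2 + (2 : ℝ) • sprayVec ℓ (support x q.1 q.2)))
    (by rw [map_neg, hg q hq, neg_zero])
  have hγ := hasDerivAt_line q (q.2, k)
  have hs : HasDerivAt (fun t : ℝ => support x (q + t • (q.2, k)).1 (q + t • (q.2, k)).2)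
      (geodField ℓ (support x q.1 q.2)) 0 := by
    convert hx.hasDerivAt_support hq.1 q.2 k using 1
    rw [hk, geodField, support]
    ext i <;> simp
  have hB := hx.hasDerivAt_tangent hq.1 q.2 k
  obtain ⟨N', hN⟩ : ∃ N', HasDerivAt (fun t : ℝ => normalVec ℓ x (q + t • (q.2, k))) N' 0 :=
    ⟨_, hasDerivAt_d0 hS (normalVec_smooth hx h) hγ (mem_line_zero hq)⟩
  have hN0 : HasDerivAt (fun t : ℝ => ((0 : Vec (n + 1)), normalVec ℓ x (q + t • (q.2, k))))
      (0, N') 0 := (hasDerivAt_const _ _).prodMk hN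
  have hp0 : support x (q + (0 : ℝ) • (q.2, k)).1 (q + (0 : ℝ) • (q.2, k)).2 ∈ U := by
    simpa using hp
  set p := support x q.1 q.2 with hpdef
  set N := normalVec ℓ x q with hNdef
  set B := fderiv ℝ x q.1 with hBdef
  have hgN : ∀ ξ, d2 (energy ℓ) p (0, N) (0, ξ) = coNormal x q.1 ξ := metric_normalVec h hp
  -- the derivative of `B_c`, corrected by the nonlinear connection, is tangent
  have hBt : ∀ c, ∃ e, B e = d2 x q.1 q.2 c + fderiv ℝ (sprayVec ℓ) p (0, B c) := fun c =>
    coNormal_ker hinj (hg.deriv hx h hq c)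
  -- the derivative of `N`, corrected by the nonlinear connection, is normal
  obtain ⟨c, hc⟩ : ∃ c : ℝ, N' + fderiv ℝ (sprayVec ℓ) p (0, N) = c • N := by
    refine eq_smul_normalVec h hp hinj fun e => ?_
    have key := deriv_unique_of_eqOn hS hγ (mem_line_zero hq)
      (fun t ht => (metric_normalVec h ht.2 _).trans (coNormal_tangent x _ e))
      (hasDerivAt_d2 hU hE hs hp0 hN0 (hB e)) (hasDerivAt_const _ _)
    simp only [zero_smul, add_zero] at key
    have h0 := hg.deriv hx h hq e
    rw [← hgN, vert_add, map_add] at h0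
    rw [vert_add, map_add, add_apply]
    have h1 := h.geod_metric hp N (B e)
    linarith
  have key := deriv_unique_of_eqOn hS hγ (mem_line_zero hq) (fun t ht => hM _ ht a b)
    (hasDerivAt_d3 hU hE hs hp0 hN0 (hB a) (hB b)) (hasDerivAt_const _ _)
  simp only [zero_smul, add_zero] at key
  have kN : d3 (energy ℓ) p (0, N') (0, B a) (0, B b) +
      d3 (energy ℓ) p (0, fderiv ℝ (sprayVec ℓ) p (0, N)) (0, B a) (0, B b) = 0 := by
    rw [← add_apply, ← add_apply, ← map_add, ← vert_add, hc, vert_smul, map_smul, smul_apply,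
      smul_apply, hM q hq, smul_zero]
  have ka : d3 (energy ℓ) p (0, N) (0, d2 x q.1 q.2 a) (0, B b) +
      d3 (energy ℓ) p (0, N) (0, fderiv ℝ (sprayVec ℓ) p (0, B a)) (0, B b) = 0 := by
    obtain ⟨e, he⟩ := hBt a
    rw [← add_apply, ← map_add, ← vert_add, ← he]
    exact hM q hq e b
  have kb : d3 (energy ℓ) p (0, N) (0, B a) (0, d2 x q.1 q.2 b) +
      d3 (energy ℓ) p (0, N) (0, B a) (0, fderiv ℝ (sprayVec ℓ) p (0, B b)) = 0 := by
    obtain ⟨e, he⟩ := hBt b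
    rw [← map_add, ← vert_add, ← he]
    exact hM q hq a e
  have hb := hg.deriv₂ hx h hq b a
  rw [map_add, d2_symm hx.isOpen hx.smooth hq.1 b a,
    ← hgN (d2 (sprayVec ℓ) p (0, B b) (0, B a))] at hb
  have hF := h.cartan_berwald hp N (B a) (B b)
  linarith

/-- If at every supporting element the normals with respect to `ℓ` are normal with respect to `ℓ'`,
then `M_αβ = 0` passes from `ℓ` to `ℓ'`: the condition `M_αβ = 0` says that the normal direction
does not depend on the supporting element. -/
lemma VTensorVanishesLocal.transfer (hx : IsLocalHypersurface O x) (h : IsLocalFinsler U ℓ)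
    (h' : IsLocalFinsler U ℓ') (hM : VTensorVanishesLocal O U x ℓ)
    (hperp : ∀ q ∈ supportSet O U x, ∀ a, d2 (energy ℓ') (support x q.1 q.2)
      (0, normalVec ℓ x q) (0, fderiv ℝ x q.1 a) = 0) :
    VTensorVanishesLocal O U x ℓ' := by
  intro q hq a b
  have hU := h.isOpen
  have hinj := hx.immersion q.1 hq.1
  have hS := hx.isOpen_supportSet hU
  have hγ := hasDerivAt_line q (0, a)
  have hs : HasDerivAt (fun t : ℝ => support x (q + t • (0, a)).1 (q + t • (0, a)).2)
      (0, fderiv ℝ x q.1 a) 0 := by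
    simpa using hx.hasDerivAt_support hq.1 0 a
  have hB : HasDerivAt (fun t : ℝ => ((0 : Vec (n + 1)), fderiv ℝ x (q + t • (0, a)).1 b))
      0 0 := by
    have := hx.hasDerivAt_tangent hq.1 0 a b
    rwa [map_zero, zero_apply, Prod.mk_zero_zero] at this
  obtain ⟨N', hN⟩ : ∃ N', HasDerivAt (fun t : ℝ => normalVec ℓ x (q + t • (0, a))) N' 0 :=
    ⟨_, hasDerivAt_d0 hS (normalVec_smooth hx h) hγ (mem_line_zero hq)⟩
  have hN0 : HasDerivAt (fun t : ℝ => ((0 : Vec (n + 1)), normalVec ℓ x (q + t • (0, a))))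
      (0, N') 0 := (hasDerivAt_const _ _).prodMk hN
  have hp0 : support x (q + (0 : ℝ) • (0, a)).1 (q + (0 : ℝ) • (0, a)).2 ∈ U := by
    simpa using hq.2
  obtain ⟨c, hc⟩ : ∃ c : ℝ, N' = c • normalVec ℓ x q := by
    refine eq_smul_normalVec h hq.2 hinj fun e => ?_
    have hB' : HasDerivAt (fun t : ℝ => ((0 : Vec (n + 1)), fderiv ℝ x (q + t • (0, a)).1 e))
        0 0 := by
      have := hx.hasDerivAt_tangent hq.1 0 a e
      rwa [map_zero, zero_apply, Prod.mk_zero_zero] at this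
    have key := deriv_unique_of_eqOn hS hγ (mem_line_zero hq)
      (fun t ht => (metric_normalVec h ht.2 _).trans (coNormal_tangent x _ e))
      (hasDerivAt_d2 hU h.energy_smooth hs hp0 hN0 hB') (hasDerivAt_const _ _)
    simp only [zero_smul, add_zero, map_zero] at key
    rw [d3_symm₁₂ hU h.energy_smooth hq.2, hM q hq, zero_add] at key
    exact key
  have key := deriv_unique_of_eqOn hS hγ (mem_line_zero hq) (fun t ht => hperp _ ht b)
    (hasDerivAt_d2 hU h'.energy_smooth hs hp0 hN0 hB) (hasDerivAt_const _ _)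
  simp only [zero_smul, add_zero, map_zero] at key
  rw [hc, vert_smul, map_smul, smul_apply, hperp q hq, smul_zero, add_zero,
    d3_symm₁₂ hU h'.energy_smooth hq.2] at key
  obtain ⟨k, hk⟩ := eq_smul_normalVec h' hq.2 hinj (hperp q hq)
  have hk0 : k ≠ 0 := by
    rintro rfl
    exact normalVec_ne_zero h hq.2 hinj (by simpa using hk)
  rw [hk, vert_smul, map_smul, smul_apply, smul_apply, smul_eq_mul] at key
  exact (mul_eq_zero.1 key).resolve_left hk0

/-- The geodesic condition passes from `ℓ` to `ℓ'` if the difference of the sprays is tangent to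
the hypersurface. -/
lemma IsGeodesicLocal.transfer (hg : IsGeodesicLocal O U x ℓ)
    (hG : ∀ q ∈ supportSet O U x, coNormal x q.1 (sprayVec ℓ' (support x q.1 q.2)) =
      coNormal x q.1 (sprayVec ℓ (support x q.1 q.2))) :
    IsGeodesicLocal O U x ℓ' := by
  intro q hq
  have := hg q hq
  rw [map_add, map_smul] at this ⊢
  rw [hG q hq, this]

end Geodesic

/-! ### The fundamental tensors of a hypersurface -/

section FundamentalTensors

variable {n : ℕ} {O : Set (Vec n)} {x : Vec n → Vec (n + 1)}
  {U : Set (Vec (n + 1) × Vec (n + 1))} {ℓ ℓ' : Vec (n + 1) × Vec (n + 1) → ℝ} {u : Vec n}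
  {q : Vec n × Vec n} {N : Vec (n + 1)}

lemma projFactor_eq (hx : IsLocalHypersurface O x) (hu : u ∈ O) (i : Fin (n + 1)) (α : Fin n) :
    projFactor x i α u = fderiv ℝ x u (coordVec α) i := by
  have := (EuclideanSpace.proj (𝕜 := ℝ) i).hasFDerivAt.comp u
    (differentiableAt_of_smoothOn hx.isOpen hx.smooth hu).hasFDerivAt
  rw [projFactor, show (fun w => x w i) = (EuclideanSpace.proj (𝕜 := ℝ) i) ∘ x from rfl,
    this.fderiv]
  rfl

lemma projFactor₂_eq (hx : IsLocalHypersurface O x) (hu : u ∈ O) (i : Fin (n + 1))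
    (α β : Fin n) :
    projFactor₂ x i α β u = d2 x u (coordVec α) (coordVec β) i := by
  have hd := differentiableAt_of_smoothOn hx.isOpen (smoothOn_fderiv hx.isOpen hx.smooth) hu
  have := (EuclideanSpace.proj (𝕜 := ℝ) i).hasFDerivAt.comp u
    (hd.clm_apply (differentiableAt_const (coordVec β))).hasFDerivAt
  rw [projFactor₂, fderiv_eq_of_eqOn hx.isOpen (fun w hw => projFactor_eq hx hw i β) hu,
    show (fun w => fderiv ℝ x w (coordVec β) i) =
      (EuclideanSpace.proj (𝕜 := ℝ) i) ∘ fun w => fderiv ℝ x w (coordVec β) from rfl,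
    this.fderiv, ContinuousLinearMap.comp_apply, fderiv_clm_apply_const hd]
  rfl

lemma isUnitNormal_iff (hx : IsLocalHypersurface O x) (h : IsLocalFinsler U ℓ)
    (hq : q ∈ supportSet O U x) :
    IsUnitNormal ℓ x q.1 q.2 N ↔
      (∀ a, d2 (energy ℓ) (support x q.1 q.2) (0, N) (0, fderiv ℝ x q.1 a) = 0) ∧
        d2 (energy ℓ) (support x q.1 q.2) (0, N) (0, N) = 1 := by
  rw [IsUnitNormal, sum_metric h hq.2]
  refine and_congr_left fun _ => ?_
  have e : ∀ α, ∑ i, ∑ j, metric ℓ i j (support x q.1 q.2) * projFactor x i α q.1 * N j =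
      d2 (energy ℓ) (support x q.1 q.2) (0, N) (0, fderiv ℝ x q.1 (coordVec α)) := by
    intro α
    rw [d2_symm h.isOpen h.energy_smooth hq.2, ← sum_metric h hq.2]
    simp_rw [projFactor_eq hx hq.1]
  simp_rw [e]
  refine ⟨fun H a => ?_, fun H α => H _⟩
  have hl : IsLinearMap ℝ fun a : Vec n =>
      d2 (energy ℓ) (support x q.1 q.2) (0, N) (0, fderiv ℝ x q.1 a) := by
    constructor
    · intro a b; simp only [map_add, vert_add]
    · intro c a; simp only [map_smul, vert_smul]
  rw [← show _ = d2 (energy ℓ) (support x q.1 q.2) (0, N) (0, fderiv ℝ x q.1 a) from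
    sum_coord hl.mk' a]
  exact Finset.sum_eq_zero fun α _ => by
    simp only [IsLinearMap.mk'_apply, H, zero_mul]

/-- Normalizing `normalVec` gives a unit normal. -/
lemma exists_isUnitNormal (hx : IsLocalHypersurface O x) (h : IsLocalFinsler U ℓ)
    (hq : q ∈ supportSet O U x) :
    ∃ c : ℝ, c ≠ 0 ∧ IsUnitNormal ℓ x q.1 q.2 (c • normalVec ℓ x q) := by
  have hpos := metric_pos h hq.2 (normalVec_ne_zero h hq.2 (hx.immersion _ hq.1))
  set r := d2 (energy ℓ) (support x q.1 q.2) (0, normalVec ℓ x q) (0, normalVec ℓ x q) with hr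
  refine ⟨(√r)⁻¹, by positivity, (isUnitNormal_iff hx h hq).2 ⟨fun a => ?_, ?_⟩⟩
  · rw [vert_smul, map_smul, smul_apply, metric_normalVec h hq.2, coNormal_tangent, smul_zero]
  · rw [vert_smul, map_smul, map_smul, smul_apply, ← hr, smul_eq_mul, smul_eq_mul, ← mul_assoc,
      ← mul_inv, Real.mul_self_sqrt hpos.le, inv_mul_cancel₀ hpos.ne']

/-- A unit normal is a multiple of `normalVec`. -/
lemma IsUnitNormal.eq_smul (hx : IsLocalHypersurface O x) (h : IsLocalFinsler U ℓ)
    (hq : q ∈ supportSet O U x) (hN : IsUnitNormal ℓ x q.1 q.2 N) :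
    ∃ c : ℝ, N = c • normalVec ℓ x q :=
  eq_smul_normalVec h hq.2 (hx.immersion _ hq.1) ((isUnitNormal_iff hx h hq).1 hN).1

lemma secondFundV_eq (hx : IsLocalHypersurface O x) (h : IsLocalFinsler U ℓ)
    (hq : q ∈ supportSet O U x) (N : Vec (n + 1)) (α β : Fin n) :
    secondFundV ℓ x q.1 q.2 N α β = (1 / 2) * d3 (energy ℓ) (support x q.1 q.2) (0, N)
      (0, fderiv ℝ x q.1 (coordVec α)) (0, fderiv ℝ x q.1 (coordVec β)) := by
  rw [d3_symm₁₂ h.isOpen h.energy_smooth hq.2, d3_symm₂₃ h.isOpen h.energy_smooth hq.2,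
    ← sum_cartan h hq.2, secondFundV]
  simp_rw [projFactor_eq hx hq.1]

lemma vecM_eq (hx : IsLocalHypersurface O x) (h : IsLocalFinsler U ℓ)
    (hq : q ∈ supportSet O U x) (N : Vec (n + 1)) (α : Fin n) :
    vecM ℓ x q.1 q.2 N α = (1 / 2) * d3 (energy ℓ) (support x q.1 q.2)
      (0, fderiv ℝ x q.1 (coordVec α)) (0, N) (0, N) := by
  rw [← sum_cartan h hq.2, vecM]
  simp_rw [projFactor_eq hx hq.1]

lemma sum_conormal (h : IsLocalFinsler U ℓ) (hq : q ∈ supportSet O U x) (N w : Vec (n + 1)) :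
    ∑ i, conormal ℓ x q.1 q.2 N i * w i =
      d2 (energy ℓ) (support x q.1 q.2) (0, N) (0, w) := by
  rw [d2_symm h.isOpen h.energy_smooth hq.2, ← sum_metric h hq.2]
  simp_rw [conormal, Finset.sum_mul]
  exact Finset.sum_congr rfl fun i _ => Finset.sum_congr rfl fun j _ => by ring

lemma normalCurv_eq (hx : IsLocalHypersurface O x) (h : IsLocalFinsler U ℓ)
    (hq : q ∈ supportSet O U x) (N : Vec (n + 1)) (α : Fin n) :
    normalCurv ℓ x q.1 q.2 N α = d2 (energy ℓ) (support x q.1 q.2) (0, N)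
      (0, d2 x q.1 q.2 (coordVec α) +
        fderiv ℝ (sprayVec ℓ) (support x q.1 q.2) (0, fderiv ℝ x q.1 (coordVec α))) := by
  rw [← sum_conormal h hq, normalCurv]
  refine Finset.sum_congr rfl fun i _ => ?_
  rw [PiLp.add_apply]
  congr 2
  · simp_rw [projFactor₂_eq hx hq.1]
    exact sum_coord ((EuclideanSpace.proj (𝕜 := ℝ) i).toLinearMap ∘ₗ
      ((d2 x q.1).flip (coordVec α)).toLinearMap) q.2
  · simp_rw [projFactor_eq hx hq.1, nonlin_eq h hq.2]
    exact sum_coord ((EuclideanSpace.proj (𝕜 := ℝ) i).toLinearMap ∘ₗ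
      (fderiv ℝ (sprayVec ℓ) (support x q.1 q.2)).toLinearMap ∘ₗ
      LinearMap.inr ℝ (Vec (n + 1)) (Vec (n + 1))) _

lemma secondFundH_eq (hx : IsLocalHypersurface O x) (h : IsLocalFinsler U ℓ)
    (hq : q ∈ supportSet O U x) (N : Vec (n + 1)) (α β : Fin n) :
    secondFundH ℓ x q.1 q.2 N α β =
      d2 (energy ℓ) (support x q.1 q.2) (0, N) (0, d2 x q.1 (coordVec α) (coordVec β)) +
      (1 / 2) *
      (d3 (energy ℓ) (support x q.1 q.2)
          (hlift ℓ (support x q.1 q.2) (fderiv ℝ x q.1 (coordVec α)))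
          (0, N) (0, fderiv ℝ x q.1 (coordVec β)) +
        d3 (energy ℓ) (support x q.1 q.2)
          (hlift ℓ (support x q.1 q.2) (fderiv ℝ x q.1 (coordVec β)))
          (0, N) (0, fderiv ℝ x q.1 (coordVec α)) -
        d3 (energy ℓ) (support x q.1 q.2) (hlift ℓ (support x q.1 q.2) N)
          (0, fderiv ℝ x q.1 (coordVec α)) (0, fderiv ℝ x q.1 (coordVec β))) +
      vecM ℓ x q.1 q.2 N α * normalCurv ℓ x q.1 q.2 N β := by
  rw [secondFundH, ← sum_cartanConn h hq.2, ← sum_conormal h hq]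
  simp_rw [projFactor₂_eq hx hq.1, projFactor_eq hx hq.1, mul_add, Finset.sum_add_distrib]
  rfl

lemma VTensorVanishesLocal.secondFundV_eq_zero (hx : IsLocalHypersurface O x)
    (h : IsLocalFinsler U ℓ) (hM : VTensorVanishesLocal O U x ℓ) (hq : q ∈ supportSet O U x)
    (hN : IsUnitNormal ℓ x q.1 q.2 N) (α β : Fin n) : secondFundV ℓ x q.1 q.2 N α β = 0 := by
  obtain ⟨c, rfl⟩ := hN.eq_smul hx h hq
  rw [secondFundV_eq hx h hq, vert_smul, map_smul, smul_apply, smul_apply, hM q hq, smul_zero,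
    mul_zero]

lemma vTensorVanishesLocal_of_secondFundV (hx : IsLocalHypersurface O x)
    (h : IsLocalFinsler U ℓ)
    (H : ∀ q ∈ supportSet O U x, ∀ N, IsUnitNormal ℓ x q.1 q.2 N →
      ∀ α β, secondFundV ℓ x q.1 q.2 N α β = 0) : VTensorVanishesLocal O U x ℓ := by
  intro q hq a b
  obtain ⟨c, hc, hN⟩ := exists_isUnitNormal hx h hq
  have h1 : ∀ α β, d3 (energy ℓ) (support x q.1 q.2) (0, normalVec ℓ x q)
      (0, fderiv ℝ x q.1 (coordVec α)) (0, fderiv ℝ x q.1 (coordVec β)) = 0 := by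
    intro α β
    have := H q hq _ hN α β
    rw [secondFundV_eq hx h hq, vert_smul, map_smul, smul_apply, smul_apply, smul_eq_mul] at this
    simpa [hc] using this
  rw [← sum_coord_coord (fun a b => d3 (energy ℓ) (support x q.1 q.2) (0, normalVec ℓ x q)
    (0, fderiv ℝ x q.1 a) (0, fderiv ℝ x q.1 b)) (fun b => ⟨?_, ?_⟩) (fun a => ⟨?_, ?_⟩) a b]
  · simp [h1]
  · intro a b; simp only [map_add, vert_add, add_apply]
  · intro c a; simp only [map_smul, vert_smul, smul_apply]
  · intro a b; simp only [map_add, vert_add]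
  · intro c a; simp only [map_smul, vert_smul]

lemma metric_smul_normalVec (h : IsLocalFinsler U ℓ) (hq : support x q.1 q.2 ∈ U) (c : ℝ)
    (w : Vec (n + 1)) :
    d2 (energy ℓ) (support x q.1 q.2) (0, c • normalVec ℓ x q) (0, w) = c * coNormal x q.1 w := by
  rw [vert_smul, map_smul, smul_apply, metric_normalVec h hq, smul_eq_mul]

/-- `H_αβ = 0` implies `H_αβ v^α v^β = N_i (B^i_αβ v^α v^β + 2 G^i) = 0`, because
`M_α v^α = 0`. -/
lemma isGeodesicLocal_of_secondFundH (hx : IsLocalHypersurface O x)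
    (h : IsLocalFinsler U ℓ)
    (H : ∀ q ∈ supportSet O U x, ∀ N, IsUnitNormal ℓ x q.1 q.2 N →
      ∀ α β, secondFundH ℓ x q.1 q.2 N α β = 0) : IsGeodesicLocal O U x ℓ := by
  intro q hq
  obtain ⟨c, hc, hN⟩ := exists_isUnitNormal hx h hq
  have h1 := H q hq _ hN
  set N := c • normalVec ℓ x q with hNdef
  set p := support x q.1 q.2 with hp
  have hpU : p ∈ U := hq.2
  set ν : Vec n →L[ℝ] ℝ := (d2 (energy ℓ) p (0, N)) ∘L
    (ContinuousLinearMap.inr ℝ (Vec (n + 1)) (Vec (n + 1))) ∘L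
      (d2 x q.1 q.2 + fderiv ℝ (sprayVec ℓ) p ∘L
        (ContinuousLinearMap.inr ℝ (Vec (n + 1)) (Vec (n + 1))) ∘L fderiv ℝ x q.1) with hν
  set b : Vec n → Vec n → ℝ := fun a b =>
      d2 (energy ℓ) p (0, N) (0, d2 x q.1 a b) + (1 / 2) *
      (d3 (energy ℓ) p (hlift ℓ p (fderiv ℝ x q.1 a)) (0, N) (0, fderiv ℝ x q.1 b) +
        d3 (energy ℓ) p (hlift ℓ p (fderiv ℝ x q.1 b)) (0, N) (0, fderiv ℝ x q.1 a) -
        d3 (energy ℓ) p (hlift ℓ p N) (0, fderiv ℝ x q.1 a) (0, fderiv ℝ x q.1 b)) +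
      (1 / 2) * d3 (energy ℓ) p (0, fderiv ℝ x q.1 a) (0, N) (0, N) * ν b with hb
  have hb0 : ∀ α β, b (coordVec α) (coordVec β) = 0 := by
    intro α β
    rw [← h1 α β, secondFundH_eq hx h hq, vecM_eq hx h hq, normalCurv_eq hx h hq]
    rfl
  have hbv : b q.2 q.2 = 0 := by
    rw [← sum_coord_coord b (fun b => ⟨?_, ?_⟩) (fun a => ⟨?_, ?_⟩) q.2 q.2]
    · simp [hb0]
    · intro a b; simp only [hb, map_add, vert_add, add_apply]; ring
    · intro c a; simp only [hb, map_smul, vert_smul, smul_apply, smul_eq_mul]; ring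
    · intro a b; simp only [hb, map_add, vert_add, add_apply]; ring
    · intro c a; simp only [hb, map_smul, vert_smul, smul_apply, smul_eq_mul]; ring
  have hy : fderiv ℝ x q.1 q.2 = p.2 := rfl
  have hU := h.isOpen
  have hE := h.energy_smooth
  have r1 : d3 (energy ℓ) p (0, p.2) (0, N) (0, N) = 0 := by
    rw [d3_symm₁₂ hU hE hpU, d3_symm₂₃ hU hE hpU, h.cartan_radial hpU]
  have r2 := h.d3_euler hpU (hlift ℓ p p.2) (0, N)
  have r3 := h.d3_euler hpU (hlift ℓ p N) (0, p.2)
  have r4 := h.d2_euler hpU (hlift ℓ p N)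
  have r5 := sum_metric_spray h hpU N
  have r6 := h.metric_radial hpU (fderiv ℝ (sprayVec ℓ) p (0, N))
  have r7 := d2_symm hU hE hpU (0, p.2) (0, fderiv ℝ (sprayVec ℓ) p (0, N))
  have r8 := d2_symm hU hE hpU (0, N) (0, fderiv ℝ (sprayVec ℓ) p (0, p.2))
  have hsnd : ∀ ξ, ((0 : Vec (n + 1)), (hlift ℓ p ξ).2) =
      -((0 : Vec (n + 1)), fderiv ℝ (sprayVec ℓ) p (0, ξ)) := by
    intro ξ
    simp [hlift_apply]
  rw [hsnd, map_neg] at r2 r3 r4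
  simp only [hlift_split, map_sub, sub_apply] at r2 r3 r4
  simp only [hb, hy, r1, hlift_split, map_sub, sub_apply] at hbv
  have hfin : d2 (energy ℓ) p (0, N) (0, d2 x q.1 q.2 q.2 + (2 : ℝ) • sprayVec ℓ p) = 0 := by
    rw [vert_add, map_add, vert_smul 2, map_smul, smul_eq_mul]
    linarith
  rw [hNdef, hp, metric_smul_normalVec h hq.2] at hfin
  exact (mul_eq_zero.1 hfin).resolve_left hc

lemma IsGeodesicLocal.secondFundH_eq_zero (hx : IsLocalHypersurface O x)
    (h : IsLocalFinsler U ℓ) (hg : IsGeodesicLocal O U x ℓ) (hM : VTensorVanishesLocal O U x ℓ)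
    (hq : q ∈ supportSet O U x) (hN : IsUnitNormal ℓ x q.1 q.2 N) (α β : Fin n) :
    secondFundH ℓ x q.1 q.2 N α β = 0 := by
  obtain ⟨c, rfl⟩ := hN.eq_smul hx h hq
  have key := hg.secondFund_eq_zero hx h hM hq (coordVec α) (coordVec β)
  rw [secondFundH_eq hx h hq, normalCurv_eq hx h hq, metric_smul_normalVec h hq.2,
    metric_smul_normalVec h hq.2, hg.deriv hx h hq]
  simp only [vert_smul, map_smul, smul_apply, smul_eq_mul]
  linear_combination c * key

end FundamentalTensors

/-! ### The h-vector and the exponential change in a chart -/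

/-- `β = b_i y^i`. -/
def hform {m : ℕ} (b : Fin m → Vec m × Vec m → ℝ) (p : Vec m × Vec m) : ℝ :=
  ∑ i, b i p * p.2 i

/-- A gradient h-vector in a chart; the function `ρ` may have zeros. -/
structure IsLocalHVector {m : ℕ} (U : Set (Vec m × Vec m)) (ℓ : Vec m × Vec m → ℝ)
    (b : Fin m → Vec m × Vec m → ℝ) : Prop where
  smooth : ∀ i, ContDiffOn ℝ ∞ (b i) U
  vcov_eq_zero : ∀ p ∈ U, ∀ i k, vcov ℓ b i k p = 0
  cartan_eq : ∃ ρ : Vec m × Vec m → ℝ, ∀ p ∈ U, ∀ i j,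
    ℓ p * ∑ h, cartanUp ℓ h i j p * b h p = ρ p * angular ℓ i j p
  gradient : ∀ p ∈ U, ∀ i j, hcov ℓ b i j p = hcov ℓ b j i p

section HVector

variable {m : ℕ} {U : Set (Vec m × Vec m)} {ℓ ℓ' β : Vec m × Vec m → ℝ} {p : Vec m × Vec m}
  {b : Fin m → Vec m × Vec m → ℝ}

lemma IsLocalHVector.hform_smooth (hb : IsLocalHVector U ℓ b) : ContDiffOn ℝ ∞ (hform b) U :=
  ContDiffOn.sum fun i _ => (hb.smooth i).mul
    ((EuclideanSpace.proj (𝕜 := ℝ) i).contDiff.comp contDiff_snd).contDiffOn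

/-- `∂̇_k b_i = (ρ / L) h_ik`. -/
lemma IsLocalHVector.pdy_eq (h : IsLocalFinsler U ℓ) (hb : IsLocalHVector U ℓ b) :
    ∃ κ : Vec m × Vec m → ℝ, ∀ p ∈ U, ∀ i k, fderiv ℝ (b i) p (0, coordVec k) =
      κ p * angular ℓ i k p := by
  obtain ⟨ρ, hρ⟩ := hb.cartan_eq
  refine ⟨fun p => ρ p / ℓ p, fun p hp i k => ?_⟩
  have h1 := hb.vcov_eq_zero p hp i k
  have h2 := hρ p hp i k
  have h3 := (h.pos p hp).ne'
  rw [vcov, pdy, sub_eq_zero] at h1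
  rw [h1, div_mul_eq_mul_div, ← h2, mul_div_cancel_left₀ _ h3]
  exact Finset.sum_congr rfl fun r _ => mul_comm _ _

lemma IsLocalFinsler.angular_contract (h : IsLocalFinsler U ℓ) (hp : p ∈ U) (ξ : Vec m)
    (i : Fin m) :
    ∑ k, angular ℓ i k p * ξ k = d2 (energy ℓ) p (0, coordVec i) (0, ξ) -
      fderiv ℝ ℓ p (0, coordVec i) * fderiv ℝ ℓ p (0, ξ) := by
  rw [← sum_metric_right h hp, ← sum_vert (fderiv ℝ ℓ p) ξ, Finset.mul_sum,
    ← Finset.sum_sub_distrib]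
  exact Finset.sum_congr rfl fun k _ => by rw [angular, pdy, pdy]; ring

/-- The angular metric annihilates the supporting element. -/
lemma IsLocalFinsler.angular_radial (h : IsLocalFinsler U ℓ) (hp : p ∈ U) (ξ : Vec m) :
    d2 (energy ℓ) p (0, ξ) (0, p.2) - fderiv ℝ ℓ p (0, ξ) * fderiv ℝ ℓ p (0, p.2) = 0 := by
  rw [h.metric_radial hp, h.euler hp, fderiv_energy h.isOpen h.smooth hp]; ring

lemma IsLocalHVector.fderiv_hform (h : IsLocalFinsler U ℓ) (hb : IsLocalHVector U ℓ b)
    (hp : p ∈ U) (w : Vec m × Vec m) :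
    fderiv ℝ (hform b) p w = ∑ i, fderiv ℝ (b i) p w * p.2 i + ∑ i, b i p * w.2 i := by
  have hγ := hasDerivAt_line p w
  have hp' : p + (0 : ℝ) • w ∈ U := by simpa using hp
  have h1 := hasDerivAt_d0 h.isOpen hb.hform_smooth hγ hp'
  have h2 : ∀ i ∈ Finset.univ, HasDerivAt (fun t : ℝ => b i (p + t • w) * (p + t • w).2 i)
      (fderiv ℝ (b i) p w * p.2 i + b i p * w.2 i) 0 := by
    intro i _
    have h3 := hasDerivAt_d0 h.isOpen (hb.smooth i) hγ hp'
    have h4 : HasDerivAt (fun t : ℝ => (p + t • w).2 i) (w.2 i) 0 :=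
      ((EuclideanSpace.proj (𝕜 := ℝ) i) ∘L
        (ContinuousLinearMap.snd ℝ (Vec m) (Vec m))).hasFDerivAt.comp_hasDerivAt (0 : ℝ) hγ
    simpa using h3.fun_mul h4
  have := h1.unique (HasDerivAt.fun_sum h2)
  simpa [Finset.sum_add_distrib] using this

lemma IsLocalHVector.fderiv_comp_vert (h : IsLocalFinsler U ℓ) (hb : IsLocalHVector U ℓ b) :
    ∃ κ : Vec m × Vec m → ℝ, ∀ p ∈ U, ∀ i ξ, fderiv ℝ (b i) p (0, ξ) =
      κ p * (d2 (energy ℓ) p (0, ξ) (0, coordVec i) -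
        fderiv ℝ ℓ p (0, ξ) * fderiv ℝ ℓ p (0, coordVec i)) := by
  obtain ⟨κ, hκ⟩ := hb.pdy_eq h
  refine ⟨κ, fun p hp i ξ => ?_⟩
  rw [d2_symm h.isOpen h.energy_smooth hp, mul_comm (fderiv ℝ ℓ p (0, ξ)),
    ← h.angular_contract hp, ← sum_vert, Finset.mul_sum]
  exact Finset.sum_congr rfl fun k _ => by rw [hκ p hp]; ring

/-- `∂̇_i β = b_i`. -/
lemma IsLocalHVector.fderiv_hform_vert (h : IsLocalFinsler U ℓ) (hb : IsLocalHVector U ℓ b)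
    (hp : p ∈ U) (ξ : Vec m) : fderiv ℝ (hform b) p (0, ξ) = ∑ i, b i p * ξ i := by
  obtain ⟨κ, hκ⟩ := hb.fderiv_comp_vert h
  rw [hb.fderiv_hform h hp, add_eq_right]
  simp_rw [hκ p hp, mul_assoc, sub_mul, mul_assoc]
  rw [← Finset.mul_sum, Finset.sum_sub_distrib, ← Finset.mul_sum, sum_vert, sum_vert,
    h.angular_radial hp, mul_zero]

lemma IsLocalHVector.d2_hform (h : IsLocalFinsler U ℓ) (hb : IsLocalHVector U ℓ b)
    (hp : p ∈ U) (w : Vec m × Vec m) (ξ : Vec m) :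
    d2 (hform b) p w (0, ξ) = ∑ i, fderiv ℝ (b i) p w * ξ i := by
  have hγ := hasDerivAt_line p w
  have hp' : p + (0 : ℝ) • w ∈ U := by simpa using hp
  have key := deriv_unique_of_eqOn h.isOpen hγ hp' (fun t ht => hb.fderiv_hform_vert h ht ξ)
    (hasDerivAt_d1 h.isOpen hb.hform_smooth hγ hp' (hasDerivAt_const _ (0, ξ)))
    (HasDerivAt.fun_sum fun i _ =>
      (hasDerivAt_d0 h.isOpen (hb.smooth i) hγ hp').mul_const (ξ i))
  simpa using key

/-- The vertical Hessian of `β` is proportional to the angular metric. -/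
lemma IsLocalHVector.d2_hform_vert (h : IsLocalFinsler U ℓ) (hb : IsLocalHVector U ℓ b) :
    ∃ κ : Vec m × Vec m → ℝ, ∀ p ∈ U, ∀ ξ η, d2 (hform b) p (0, ξ) (0, η) =
      κ p * (d2 (energy ℓ) p (0, ξ) (0, η) - fderiv ℝ ℓ p (0, ξ) * fderiv ℝ ℓ p (0, η)) := by
  obtain ⟨κ, hκ⟩ := hb.fderiv_comp_vert h
  refine ⟨κ, fun p hp ξ η => ?_⟩
  rw [hb.d2_hform h hp]
  simp_rw [hκ p hp, mul_assoc, sub_mul, mul_assoc]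
  rw [← Finset.mul_sum, Finset.sum_sub_distrib, ← Finset.mul_sum, sum_vert, sum_vert]

lemma cartanConn_symm (h : IsLocalFinsler U ℓ) (hp : p ∈ U) (i j k : Fin m) :
    cartanConn ℓ i j k p = cartanConn ℓ i k j p := by
  have e : ∀ r, hderiv ℓ r (metric ℓ j k) p = hderiv ℓ r (metric ℓ k j) p := by
    intro r
    rw [hderiv_eq h hp, hderiv_eq h hp, fderiv_metric h hp, fderiv_metric h hp,
      d3_symm₂₃ h.isOpen h.energy_smooth hp]
  simp_rw [cartanConn, e]
  congr 1
  exact Finset.sum_congr rfl fun r _ => by ring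

/-- The gradient condition: `δ_j b_i` is symmetric. -/
lemma IsLocalHVector.d2_hform_hlift_symm (h : IsLocalFinsler U ℓ) (hb : IsLocalHVector U ℓ b)
    (hp : p ∈ U) (ξ η : Vec m) :
    d2 (hform b) p (hlift ℓ p ξ) (0, η) = d2 (hform b) p (hlift ℓ p η) (0, ξ) := by
  have e : ∀ i j, fderiv ℝ (b i) p (hlift ℓ p (coordVec j)) =
      fderiv ℝ (b j) p (hlift ℓ p (coordVec i)) := by
    intro i j
    have := hb.gradient p hp i j
    simp_rw [hcov, hderiv_eq h hp, cartanConn_symm h hp _ i j] at this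
    linarith
  have e2 : ∀ ξ η, d2 (hform b) p (hlift ℓ p ξ) (0, η) =
      ∑ i, ∑ j, fderiv ℝ (b i) p (hlift ℓ p (coordVec j)) * ξ j * η i := by
    intro ξ η
    rw [hb.d2_hform h hp]
    refine Finset.sum_congr rfl fun i _ => ?_
    rw [← Finset.sum_mul]
    congr 1
    exact (sum_coord ((fderiv ℝ (b i) p).toLinearMap ∘ₗ (hlift ℓ p).toLinearMap) ξ).symm
  rw [e2, e2, Finset.sum_comm]
  exact Finset.sum_congr rfl fun i _ => Finset.sum_congr rfl fun j _ => by rw [e]; ring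

lemma IsLocalFinsler.hlift_radial (h : IsLocalFinsler U ℓ) (hp : p ∈ U) :
    hlift ℓ p p.2 = geodField ℓ p := by
  rw [hlift_apply, geodField, h.nonlin_radial hp, neg_smul]

/-- A gradient h-vector satisfies `S (∂̇_i β) = ∂_i β` for the geodesic field `S` of `ℓ`. -/
lemma IsLocalHVector.geod_hform (h : IsLocalFinsler U ℓ) (hb : IsLocalHVector U ℓ b)
    (hp : p ∈ U) (ξ : Vec m) :
    d2 (hform b) p (geodField ℓ p) (0, ξ) = fderiv ℝ (hform b) p (ξ, 0) := by
  have hγ := hasDerivAt_line p (hlift ℓ p ξ)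
  have hp' : p + (0 : ℝ) • hlift ℓ p ξ ∈ U := by simpa using hp
  have hγ2 : HasDerivAt (fun t : ℝ => ((0 : Vec m), (p + t • hlift ℓ p ξ).2))
      (0, (hlift ℓ p ξ).2) 0 :=
    (hasDerivAt_const _ _).prodMk (by simpa using hasDerivAt_line p.2 (hlift ℓ p ξ).2)
  have key := deriv_unique_of_eqOn h.isOpen hγ hp'
    (ψ := fun t => hform b (p + t • hlift ℓ p ξ))
    (fun t ht => hb.fderiv_hform_vert h ht (p + t • hlift ℓ p ξ).2)
    (hasDerivAt_d1 h.isOpen hb.hform_smooth hγ hp' hγ2)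
    (hasDerivAt_d0 h.isOpen hb.hform_smooth hγ hp')
  simp only [zero_smul, add_zero] at key
  rw [← h.hlift_radial hp, hb.d2_hform_hlift_symm h hp, eq_sub_of_add_eq key, ← map_sub]
  congr 1
  ext <;> simp [hlift_apply]

/-! ### Comparison of a Finsler function with its exponential change -/

lemma fderiv_energy_expChange (hU : IsOpen U) (hs : ContDiffOn ℝ ∞ ℓ U)
    (hβ : ContDiffOn ℝ ∞ β U) (hpos : ∀ p ∈ U, 0 < ℓ p) (hp : p ∈ U) (w : Vec m × Vec m) :
    fderiv ℝ (energy fun p => ℓ p * Real.exp (β p / ℓ p)) p w =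
      (ℓ p - β p) * Real.exp (2 * (β p / ℓ p)) * fderiv ℝ ℓ p w +
        ℓ p * Real.exp (2 * (β p / ℓ p)) * fderiv ℝ β p w := by
  have h0 := (hpos p hp).ne'
  have hγ := hasDerivAt_line p w
  have hp' : p + (0 : ℝ) • w ∈ U := by simpa using hp
  have h1 := hasDerivAt_d0 hU hs hγ hp'
  have h2 := hasDerivAt_d0 hU hβ hγ hp'
  have hsm : ContDiffOn ℝ ∞ (fun p => ℓ p * Real.exp (β p / ℓ p)) U :=
    hs.mul (hβ.div hs fun q hq => (hpos q hq).ne').exp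
  rw [fderiv_energy hU hsm hp]
  have h3 := (h1.mul (h2.div h1 (hpos _ hp').ne').exp)
  have h4 := (hasDerivAt_d0 hU hsm hγ hp').unique h3
  simp only [zero_smul, add_zero, Pi.div_apply] at h4
  rw [h4, two_mul (β p / ℓ p), Real.exp_add]
  field_simp
  ring

/-- Where `dℓ` and `dβ` vanish on `z`, the second derivatives in the direction `z` of the energy of
`ℓ exp (β / ℓ)` are combinations of those of `ℓ` and `β`. -/
lemma d2_energy_expChange (hU : IsOpen U) (hs : ContDiffOn ℝ ∞ ℓ U)
    (hβ : ContDiffOn ℝ ∞ β U) (hpos : ∀ p ∈ U, 0 < ℓ p) (hp : p ∈ U) {z : Vec m × Vec m}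
    (hz : fderiv ℝ ℓ p z = 0) (hz' : fderiv ℝ β p z = 0) (w : Vec m × Vec m) :
    d2 (energy fun p => ℓ p * Real.exp (β p / ℓ p)) p w z =
      (ℓ p - β p) * Real.exp (2 * (β p / ℓ p)) * d2 ℓ p w z +
        ℓ p * Real.exp (2 * (β p / ℓ p)) * d2 β p w z := by
  have hγ := hasDerivAt_line p w
  have hp' : p + (0 : ℝ) • w ∈ U := by simpa using hp
  have hex : ContDiffOn ℝ ∞ (fun p => Real.exp (2 * (β p / ℓ p))) U :=
    (contDiffOn_const.mul (hβ.div hs fun q hq => (hpos q hq).ne')).exp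
  have hP : ContDiffOn ℝ ∞ (fun p => (ℓ p - β p) * Real.exp (2 * (β p / ℓ p))) U :=
    (hs.sub hβ).mul hex
  have hR : ContDiffOn ℝ ∞ (fun p => ℓ p * Real.exp (2 * (β p / ℓ p))) U := hs.mul hex
  have hsm : ContDiffOn ℝ ∞ (energy fun p => ℓ p * Real.exp (β p / ℓ p)) U :=
    contDiffOn_const.mul ((hs.mul (hβ.div hs fun q hq => (hpos q hq).ne').exp).pow 2)
  have c := hasDerivAt_const (0 : ℝ) z
  have key := deriv_unique_of_eqOn hU hγ hp'
    (fun t ht => fderiv_energy_expChange hU hs hβ hpos ht z)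
    (hasDerivAt_d1 hU hsm hγ hp' c)
    (((hasDerivAt_d0 hU hP hγ hp').fun_mul (hasDerivAt_d1 hU hs hγ hp' c)).fun_add
      ((hasDerivAt_d0 hU hR hγ hp').fun_mul (hasDerivAt_d1 hU hβ hγ hp' c)))
  simpa [hz, hz'] using key

lemma d2_of_energy (hU : IsOpen U) (hs : ContDiffOn ℝ ∞ ℓ U) (hp : p ∈ U)
    {z : Vec m × Vec m} (hz : fderiv ℝ ℓ p z = 0) (w : Vec m × Vec m) :
    d2 (energy ℓ) p w z = ℓ p * d2 ℓ p w z := by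
  have hγ := hasDerivAt_line p w
  have hp' : p + (0 : ℝ) • w ∈ U := by simpa using hp
  have hE : ContDiffOn ℝ ∞ (energy ℓ) U := contDiffOn_const.mul (hs.pow 2)
  have c := hasDerivAt_const (0 : ℝ) z
  have key := deriv_unique_of_eqOn hU hγ hp' (fun t ht => fderiv_energy hU hs ht z)
    (hasDerivAt_d1 hU hE hγ hp' c)
    ((hasDerivAt_d0 hU hs hγ hp').fun_mul (hasDerivAt_d1 hU hs hγ hp' c))
  simpa [hz] using key

/-- If `b_i N^i = 0`, a vector `ξ` and a normal `N` orthogonal to `ξ` and to `y` remain orthogonal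
after the exponential change. -/
lemma IsLocalHVector.metric_expChange (h : IsLocalFinsler U ℓ) (hb : IsLocalHVector U ℓ b)
    (hp : p ∈ U) {N ξ : Vec m} (hy : d2 (energy ℓ) p (0, N) (0, p.2) = 0)
    (hξ : d2 (energy ℓ) p (0, N) (0, ξ) = 0) (hN : ∑ i, b i p * N i = 0) :
    d2 (energy fun p => ℓ p * Real.exp (hform b p / ℓ p)) p (0, N) (0, ξ) = 0 := by
  have hU := h.isOpen
  have hpos := (h.pos p hp).ne'
  have hz : fderiv ℝ ℓ p (0, N) = 0 := by
    rw [h.metric_radial hp, fderiv_energy hU h.smooth hp] at hy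
    exact (mul_eq_zero.1 hy).resolve_left hpos
  have hz' : fderiv ℝ (hform b) p (0, N) = 0 := by rw [hb.fderiv_hform_vert h hp, hN]
  have hsm : ContDiffOn ℝ ∞ (energy fun p => ℓ p * Real.exp (hform b p / ℓ p)) U :=
    contDiffOn_const.mul ((h.smooth.mul
      (hb.hform_smooth.div h.smooth fun q hq => (h.pos q hq).ne').exp).pow 2)
  obtain ⟨κ, hκ⟩ := hb.d2_hform_vert h
  have h1 := d2_of_energy hU h.smooth hp hz (0, ξ)
  rw [d2_symm hU h.energy_smooth hp] at hξ
  rw [hξ] at h1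
  have h2 := hκ p hp ξ N
  rw [hξ, hz, mul_zero, sub_zero, mul_zero] at h2
  rw [d2_symm hU hsm hp, d2_energy_expChange hU h.smooth hb.hform_smooth h.pos hp hz hz', h2,
    (mul_eq_zero.1 h1.symm).resolve_left hpos]
  ring

/-- If `b_i N^i = 0` for a vector `N` orthogonal to `y`, then the difference of the sprays of
`ℓ exp (β / ℓ)` and `ℓ` is orthogonal to `N` with respect to the changed metric. -/
lemma IsLocalHVector.spray_expChange (h : IsLocalFinsler U ℓ) (hb : IsLocalHVector U ℓ b)
    (h' : IsLocalFinsler U fun p => ℓ p * Real.exp (hform b p / ℓ p))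
    (hp : p ∈ U) {N : Vec m} (hy : d2 (energy ℓ) p (0, N) (0, p.2) = 0)
    (hN : ∑ i, b i p * N i = 0) :
    d2 (energy fun p => ℓ p * Real.exp (hform b p / ℓ p)) p (0, N)
      (0, sprayVec (fun p => ℓ p * Real.exp (hform b p / ℓ p)) p - sprayVec ℓ p) = 0 := by
  have hU := h.isOpen
  have hpos := (h.pos p hp).ne'
  have hz : fderiv ℝ ℓ p (0, N) = 0 := by
    rw [h.metric_radial hp, fderiv_energy hU h.smooth hp] at hy
    exact (mul_eq_zero.1 hy).resolve_left hpos
  have hz' : fderiv ℝ (hform b) p (0, N) = 0 := by rw [hb.fderiv_hform_vert h hp, hN]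
  have h1 := d2_of_energy hU h.smooth hp hz (geodField ℓ p)
  rw [h.spray_eq hp, fderiv_energy hU h.smooth hp] at h1
  have h2 := mul_left_cancel₀ hpos h1
  have h3 := d2_energy_expChange hU h.smooth hb.hform_smooth h.pos hp hz hz' (geodField ℓ p)
  rw [hb.geod_hform h hp, ← h2, ← fderiv_energy_expChange hU h.smooth hb.hform_smooth h.pos hp,
    ← h'.spray_eq hp] at h3
  simp only [geodField_split, map_sub, map_smul, sub_apply, smul_apply, smul_eq_mul] at h3
  rw [sub_eq_add_neg, ← neg_one_smul ℝ, vert_add, vert_smul, map_add, map_smul, smul_eq_mul,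
    d2_symm hU h'.energy_smooth hp, d2_symm hU h'.energy_smooth hp (0, N)]
  linarith

end HVector

/-- If `b` is a gradient h-vector tangential to a hypersurface with `H_αβ = 0 = M_αβ`, then these
tensors also vanish for `ℓ exp (β / ℓ)`. -/
theorem secondFund_expChange {n : ℕ} {O : Set (Vec n)} {x : Vec n → Vec (n + 1)}
    {U : Set (Vec (n + 1) × Vec (n + 1))} {ℓ : Vec (n + 1) × Vec (n + 1) → ℝ}
    {b : Fin (n + 1) → Vec (n + 1) × Vec (n + 1) → ℝ}
    (hx : IsLocalHypersurface O x) (h : IsLocalFinsler U ℓ)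
    (h' : IsLocalFinsler U fun p => ℓ p * Real.exp (hform b p / ℓ p))
    (hb : IsLocalHVector U ℓ b)
    (htan : ∀ q ∈ supportSet O U x, ∀ N, IsUnitNormal ℓ x q.1 q.2 N →
      ∑ j, b j (support x q.1 q.2) * N j = 0)
    (hH : ∀ q ∈ supportSet O U x, ∀ N, IsUnitNormal ℓ x q.1 q.2 N →
      ∀ α β, secondFundH ℓ x q.1 q.2 N α β = 0)
    (hM : ∀ q ∈ supportSet O U x, ∀ N, IsUnitNormal ℓ x q.1 q.2 N →
      ∀ α β, secondFundV ℓ x q.1 q.2 N α β = 0)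
    {q : Vec n × Vec n} (hq : q ∈ supportSet O U x) {N : Vec (n + 1)}
    (hN : IsUnitNormal (fun p => ℓ p * Real.exp (hform b p / ℓ p)) x q.1 q.2 N) (α β : Fin n) :
    secondFundH (fun p => ℓ p * Real.exp (hform b p / ℓ p)) x q.1 q.2 N α β = 0 ∧
      secondFundV (fun p => ℓ p * Real.exp (hform b p / ℓ p)) x q.1 q.2 N α β = 0 := by
  have htan' : ∀ q ∈ supportSet O U x,
      ∑ j, b j (support x q.1 q.2) * normalVec ℓ x q j = 0 := by
    intro q hq
    obtain ⟨c, hc, hN⟩ := exists_isUnitNormal hx h hq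
    have := htan q hq _ hN
    simp only [PiLp.smul_apply, smul_eq_mul, mul_left_comm _ c] at this
    rw [← Finset.mul_sum] at this
    exact (mul_eq_zero.1 this).resolve_left hc
  have htangent : ∀ q ∈ supportSet O U x, ∀ a, d2 (energy ℓ) (support x q.1 q.2)
      (0, normalVec ℓ x q) (0, fderiv ℝ x q.1 a) = 0 := fun q hq a =>
    (metric_normalVec h hq.2 _).trans (coNormal_tangent x _ a)
  have hperp : ∀ q ∈ supportSet O U x, ∀ a,
      d2 (energy fun p => ℓ p * Real.exp (hform b p / ℓ p)) (support x q.1 q.2)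
        (0, normalVec ℓ x q) (0, fderiv ℝ x q.1 a) = 0 := fun q hq a =>
    hb.metric_expChange h hq.2 (htangent q hq q.2) (htangent q hq a) (htan' q hq)
  have hM' := (vTensorVanishesLocal_of_secondFundV hx h hM).transfer hx h h' hperp
  have hg' := (isGeodesicLocal_of_secondFundH hx h hH).transfer
    (ℓ' := fun p => ℓ p * Real.exp (hform b p / ℓ p)) (fun q hq => by
      have key := hb.spray_expChange h h' hq.2 (htangent q hq q.2) (htan' q hq)
      obtain ⟨c, hc⟩ := eq_smul_normalVec h' hq.2 (hx.immersion _ hq.1) (hperp q hq)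
      have hc0 : c ≠ 0 := by
        rintro rfl
        exact normalVec_ne_zero h hq.2 (hx.immersion _ hq.1) (by simpa using hc)
      rw [hc, metric_smul_normalVec h' hq.2] at key
      have := (mul_eq_zero.1 key).resolve_left hc0
      rw [map_sub] at this
      linarith)
  exact ⟨hg'.secondFundH_eq_zero hx h' hM' hq hN α β, hM'.secondFundV_eq_zero hx h' hq hN α β⟩

/-! ### Passage to charts -/

section Charts

variable {m : ℕ} {M : Type*} [TopologicalSpace M] [ChartedSpace (Vec m) M]
  {φ : OpenPartialHomeomorph M (Vec m)}
  {D : Set (TangentBundle (𝓡 m) M)} {L : TangentBundle (𝓡 m) M → ℝ}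

lemma chartVec_smul (φ : OpenPartialHomeomorph M (Vec m)) (p : Vec m × Vec m) (c : ℝ) :
    chartVec φ (p.1, c • p.2) = ⟨(chartVec φ p).1, c • (chartVec φ p).2⟩ := by
  simp only [chartVec]
  congr 1
  exact map_smul (mfderiv (𝓡 m) (𝓡 m) φ.symm p.1) c p.2

/-- In coordinates, the exponential change is `ℓ exp (β / ℓ)`. -/
lemma chartFun_expChange (φ : OpenPartialHomeomorph M (Vec m))
    (b : ∀ w : TangentBundle (𝓡 m) M, TangentSpace (𝓡 m) w.1 →L[ℝ] ℝ) :
    chartFun φ (expChange L b) =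
      fun p => chartFun φ L p * Real.exp (hform (chartCovec φ b) p / chartFun φ L p) := by
  funext p
  have : b (chartVec φ p) (chartVec φ p).2 = hform (chartCovec φ b) p :=
    (sum_coord ((b (chartVec φ p)).toLinearMap ∘ₗ
      (mfderiv (𝓡 m) (𝓡 m) φ.symm p.1).toLinearMap) p.2).symm
  rw [chartFun, expChange, this]
  rfl

lemma mdifferentiable_of_mem_maximalAtlas (hφ : φ ∈ IsManifold.maximalAtlas (𝓡 m) ∞ M) :
    φ.MDifferentiable (𝓡 m) (𝓡 m) :=
  ⟨(contMDiffOn_of_mem_maximalAtlas hφ).mdifferentiableOn (by simp),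
    (contMDiffOn_symm_of_mem_maximalAtlas hφ).mdifferentiableOn (by simp)⟩

variable [IsManifold (𝓡 m) ∞ M]

lemma contMDiff_tangentBundleModel (m : ℕ) :
    ContMDiff 𝓘(ℝ, Vec m × Vec m) (𝓡 m).tangent ∞
      (fun p : Vec m × Vec m => (⟨p.1, p.2⟩ : TangentBundle (𝓡 m) (Vec m))) := by
  have := contMDiff_tangentBundleModelSpaceHomeomorph_symm (I := 𝓡 m) (n := ∞)
  rw [modelWithCornersSelf_prod]
  exact this

lemma chartVec_contMDiffOn (hφ : φ ∈ IsManifold.maximalAtlas (𝓡 m) ∞ M) :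
    ContMDiffOn 𝓘(ℝ, Vec m × Vec m) (𝓡 m).tangent ∞ (chartVec φ) (φ.target ×ˢ Set.univ) := by
  have : IsManifold (𝓡 m) 1 M := IsManifold.of_le (n := ∞) (by simp)
  have h1 := (contMDiffOn_symm_of_mem_maximalAtlas hφ).contMDiffOn_tangentMapWithin (m := ∞)
    (by simp) φ.open_target.uniqueMDiffOn
  have h3 := h1.comp (contMDiff_tangentBundleModel m).contMDiffOn (s := φ.target ×ˢ Set.univ)
    (fun p hp => hp.1)
  refine h3.congr fun p hp => ?_
  have : mfderivWithin (𝓡 m) (𝓡 m) φ.symm φ.target p.1 = mfderiv (𝓡 m) (𝓡 m) φ.symm p.1 :=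
    mfderivWithin_of_isOpen φ.open_target hp.1
  simp only [Function.comp_apply, tangentMapWithin]
  rw [chartVec, ← this]

lemma isOpen_chartDomain (hφ : φ ∈ IsManifold.maximalAtlas (𝓡 m) ∞ M) (hD : IsOpen D) :
    IsOpen (chartDomain φ D) := by
  have := (chartVec_contMDiffOn hφ).continuousOn.isOpen_inter_preimage
    (φ.open_target.prod isOpen_univ) hD
  have e : chartDomain φ D = φ.target ×ˢ Set.univ ∩ chartVec φ ⁻¹' D := by
    ext p
    simp only [chartDomain, Set.mem_ofPred_eq, Set.mem_inter_iff, Set.mem_prod, Set.mem_univ,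
      and_true, Set.mem_preimage]
  rwa [e]

lemma IsFinsler.isLocalFinsler (hL : IsFinsler D L)
    (hφ : φ ∈ IsManifold.maximalAtlas (𝓡 m) ∞ M) :
    IsLocalFinsler (chartDomain φ D) (chartFun φ L) where
  isOpen := isOpen_chartDomain hφ hL.isOpen
  conic p hp c hc := ⟨hp.1, by rw [chartVec_smul]; exact hL.conic _ hp.2 c hc⟩
  smooth := by
    rw [← contMDiffOn_iff_contDiffOn]
    exact hL.smooth.comp ((chartVec_contMDiffOn hφ).mono fun p hp => ⟨hp.1, trivial⟩)
      fun p hp => hp.2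
  pos p hp := hL.pos _ hp.2
  homogeneous p hp c hc := by
    rw [chartFun, chartVec_smul]; exact hL.homogeneous _ hp.2 c hc
  posDef p hp := hL.posDef φ hφ p hp

lemma IsHVector.isLocalHVector
    {b : ∀ w : TangentBundle (𝓡 m) M, TangentSpace (𝓡 m) w.1 →L[ℝ] ℝ} (hb : IsHVector D L b)
    (hgrad : IsGradient D L b) (hφ : φ ∈ IsManifold.maximalAtlas (𝓡 m) ∞ M) :
    IsLocalHVector (chartDomain φ D) (chartFun φ L) (chartCovec φ b) where
  smooth := hb.1 φ hφ
  vcov_eq_zero := hb.2.1 φ hφ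
  cartan_eq := by
    obtain ⟨ρ, -, hρ⟩ := hb.2.2
    exact ⟨fun p => ρ (chartVec φ p), hρ φ hφ⟩
  gradient := hgrad φ hφ

end Charts

lemma IsHypersurface.isLocalHypersurface {n : ℕ} {M S : Type*} [TopologicalSpace M]
    [ChartedSpace (Vec (n + 1)) M] [IsManifold (𝓡 (n + 1)) ∞ M] [TopologicalSpace S]
    [ChartedSpace (Vec n) S] [IsManifold (𝓡 n) ∞ S] {f : S → M}
    {φ : OpenPartialHomeomorph M (Vec (n + 1))} {ψ : OpenPartialHomeomorph S (Vec n)}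
    (hf : IsHypersurface (n := n) f) (hφ : φ ∈ IsManifold.maximalAtlas (𝓡 (n + 1)) ∞ M)
    (hψ : ψ ∈ IsManifold.maximalAtlas (𝓡 n) ∞ S) :
    IsLocalHypersurface {u | u ∈ ψ.target ∧ f (ψ.symm u) ∈ φ.source} (chartParam φ ψ f) where
  isOpen := (hf.smooth.continuous.comp_continuousOn ψ.continuousOn_symm).isOpen_inter_preimage
    ψ.open_target φ.open_source
  smooth := by
    rw [← contMDiffOn_iff_contDiffOn]
    exact (contMDiffOn_of_mem_maximalAtlas hφ).comp
      (hf.smooth.comp_contMDiffOn ((contMDiffOn_symm_of_mem_maximalAtlas hψ).mono fun u hu => hu.1))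
      fun u hu => hu.2
  immersion u hu := by
    have hφ' := mdifferentiable_of_mem_maximalAtlas hφ
    have hψ' := mdifferentiable_of_mem_maximalAtlas hψ
    have d1 := (hψ'.mdifferentiableAt_symm hu.1).hasMFDerivAt
    have d2 := (hf.smooth.mdifferentiable (by simp) (ψ.symm u)).hasMFDerivAt
    have d3 := (hφ'.mdifferentiableAt hu.2).hasMFDerivAt
    have d := (d3.comp u (d2.comp u d1)).mfderiv
    have e : chartParam φ ψ f = φ ∘ f ∘ ψ.symm := rfl
    rw [← mfderiv_eq_fderiv, e, d]
    exact (hφ'.mfderiv_injective hu.2).comp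
      ((hf.immersion _).comp (hψ'.symm.mfderiv_injective hu.1))

end FinslerHyp

end

theorem theorem5p1 {n : ℕ}
    {M : Type*} [TopologicalSpace M] [ChartedSpace (FinslerHyp.Vec (n + 1)) M]
    [IsManifold (𝓡 (n + 1)) ∞ M]
    {S : Type*} [TopologicalSpace S] [ChartedSpace (FinslerHyp.Vec n) S]
    [IsManifold (𝓡 n) ∞ S]
    (D : Set (TangentBundle (𝓡 (n + 1)) M)) (L : TangentBundle (𝓡 (n + 1)) M → ℝ)
    (b : ∀ w : TangentBundle (𝓡 (n + 1)) M, TangentSpace (𝓡 (n + 1)) w.1 →L[ℝ] ℝ)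
    (f : S → M)
    (hL : FinslerHyp.IsFinsler D L)
    (hLstar : FinslerHyp.IsFinsler D (FinslerHyp.expChange L b))
    (hf : FinslerHyp.IsHypersurface (n := n) f)
    (hb : FinslerHyp.IsHVector D L b)
    (hgrad : FinslerHyp.IsGradient D L b)
    (htan : FinslerHyp.IsTangential D L b f)
    (hP : FinslerHyp.IsStarP D L) :
    (FinslerHyp.IsHyperplaneSecondKind D L f → FinslerHyp.VTensorVanishes D L f →
        FinslerHyp.IsHyperplaneSecondKind D (FinslerHyp.expChange L b) f) ∧
      (FinslerHyp.IsHyperplaneThirdKind D L f →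
        FinslerHyp.IsHyperplaneThirdKind D (FinslerHyp.expChange L b) f) := by
  have key : FinslerHyp.IsHyperplaneSecondKind D L f → FinslerHyp.VTensorVanishes D L f →
      FinslerHyp.IsHyperplaneThirdKind D (FinslerHyp.expChange L b) f := by
    intro hH hM
    have main : ∀ φ ∈ IsManifold.maximalAtlas (𝓡 (n + 1)) ∞ M,
        ∀ ψ ∈ IsManifold.maximalAtlas (𝓡 n) ∞ S,
        ∀ q ∈ FinslerHyp.chartSupport φ ψ f D, ∀ N : FinslerHyp.Vec (n + 1),
        FinslerHyp.IsUnitNormal (FinslerHyp.chartFun φ (FinslerHyp.expChange L b))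
          (FinslerHyp.chartParam φ ψ f) q.1 q.2 N → ∀ α β,
        FinslerHyp.secondFundH (FinslerHyp.chartFun φ (FinslerHyp.expChange L b))
          (FinslerHyp.chartParam φ ψ f) q.1 q.2 N α β = 0 ∧
        FinslerHyp.secondFundV (FinslerHyp.chartFun φ (FinslerHyp.expChange L b))
          (FinslerHyp.chartParam φ ψ f) q.1 q.2 N α β = 0 := by
      intro φ hφ ψ hψ q hq N hN α β
      have h' := hLstar.isLocalFinsler hφ
      rw [FinslerHyp.chartFun_expChange] at hN h' ⊢
      refine FinslerHyp.secondFund_expChange (hf.isLocalHypersurface hφ hψ)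
        (hL.isLocalFinsler hφ) h' (hb.isLocalHVector hgrad hφ) ?_ ?_ ?_
        ⟨⟨hq.1, hq.2.1⟩, hq.2.2⟩ hN α β
      · exact fun q hq => htan φ hφ ψ hψ q ⟨hq.1.1, hq.1.2, hq.2⟩
      · exact fun q hq => hH φ hφ ψ hψ q ⟨hq.1.1, hq.1.2, hq.2⟩
      · exact fun q hq => hM φ hφ ψ hψ q ⟨hq.1.1, hq.1.2, hq.2⟩
    exact ⟨fun φ hφ ψ hψ q hq N hN α β => (main φ hφ ψ hψ q hq N hN α β).1,
      fun φ hφ ψ hψ q hq N hN α β => (main φ hφ ψ hψ q hq N hN α β).2⟩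
  exact ⟨fun hH hM => (key hH hM).1, fun h => key h.1 h.2⟩
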